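/- **Setting.** A computation tree $\mathcal T$ is a finite rooted tree with root $r$ in which the children of each vertex $u$ are indexed by $[\deg(u)]$; the transition from the parent of $v$ to $v$ takes $t_v$ steps, with $t_r=0$ and $t_v\ge 1$ for $v\neq r$; some of the leaves are marked. Vertices have distinct descriptions $|v\rangle$ (basis states of a finite-dimensional work register with a blank basis state $|0\rangle$). Write $D(\mathcal T)$ for the depth, $T(\mathcal T)=\sum_v t_v^2$, and $t_{\max}(\mathcal T)=\max_v t_v$. The tree is accessible only through four unitary oracles (arbitrary on all other inputs), which may be applied, together with their inverses, with controls and in superposition: $$C|v\rangle|0\rangle=|v\rangle|\deg(v)\rangle,\qquad M|v\rangle|0\rangle=|v\rangle|\mathbb 1[v\text{ is marked}]\rangle,$$ and, if $v$ is the $i$-th child of $u$ and $|v_0\rangle=|0\rangle,|v_1\rangle,\dots,|v_{t_v}\rangle=|v\rangle$ are the states of the work register after $0,1,\dots,t_v$ steps, $$A|u\rangle|i\rangle|v_t\rangle|t\rangle=|u\rangle|i\rangle|v_{t+1}\rangle|t+1\rangle\ (0\le t<t_v),\qquad O_f|u\rangle|i\rangle|v_t\rangle|t\rangle|0\rangle=|u\rangle|i\rangle|v_t\rangle|t\rangle|\mathbb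 1[t\ge t_v]\rangle\ (0\le t\le t_v).$$ The times $t_v$ are unknown. The algorithm knows the registers, the blank state, the description of the root, a bound $\Delta$ on the degrees, and upper bounds $D,t_{\max},T\ge 1$ on $D(\mathcal T)$, $t_{\max}(\mathcal T)$, $T(\mathcal T)$. **The walk step $U$.** For $v\ne r$ let $h_v=2^{\lfloor\log_2 t_v\rfloor+1}-1$, the least number $1+2+\dots+2^a$ that is at least $t_v$. The expanded tree $\mathcal E$ has the root $r$ and vertices $s(v,j)$, $v\neq r$, $1\le j\le h_v$; the edge from $u$ to its child $v$ is replaced by the path $s(u,h_u),s(v,1),\dots,s(v,h_v)$, where $s(r,h_r):=r$. The vertex $s(v,h_v)$ is marked iff $v$ is, $r$ is marked in $\mathcal E$ iff it is in $\mathcal T$, and no other vertex is marked. The weights are $w_r=1/(D(\lfloor\log_2 t_{\max}\rfloor+1))$ and $w_{s(v,j)}=2^{\lfloor\log_2 j\rfloor}$. On the span of $x$ and its children let $D_x=I$ if $x$ is marked and $D_x=I-2|\psi_x\rangle\langle\psi_x|$ otherwise, where $|\psi_x\rangle\propto\sqrt{w_x}|x\rangle+\sum_{y\text{ child of }x}\sqrt{w_y}|y\rangle$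 is a unit vector. Then $U=R_BR_A$, where $R_A=\bigoplus_x D_x$ over the vertices $x$ at even distance from $r$, and $R_B=|r\rangle\langle r|+\bigoplus_x D_x$ over those at odd distance. **Theorem.** There are absolute constants $c,q$ such that for all values of the known data above there is a quantum algorithm (independent of the tree and of the oracles) with the following properties. 1. It uses at most $c\sqrt{TD(1+\log t_{\max})}$ (controlled) applications of $U$ or $U^{-1}$, i.e. $O(\sqrt{TD\log t_{\max}})$ of them when $t_{\max}\ge 2$. It consists of these and of fixed unitaries that make no oracle calls. Here $U$ is applied through a fixed subroutine that makes at most $q$ calls to the oracles $C,M,A,O_f$ and their inverses. 2. For every computation tree within the bounds, and all oracles for it as above, the subroutine implements $U$: it acts as $U$ on an isometrically encoded copy of $\mathbb C^{\mathcal E}$, in which $|r\rangle$ is encoded by a fixed known basis state. The algorithm accepts with probability at least $2/3$ if $\mathcal T$ has a marked vertex, and with probability at most $1/3$ if it has none. -/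

import Mathlib

open scoped Matrix Kronecker

noncomputable section

/-! ## Quantum query circuits -/

/-- The computational basis state `|i⟩`. -/
def ket {ι : Type} [DecidableEq ι] (i : ι) : ι → ℂ := Pi.single i 1

/-- A gate on the space with orthonormal basis `S`, with access to a family of black-box operators,
the operator number `o` acting on the register with basis `Q o`.

* `free U`: a fixed unitary, independent of the black boxes.
* `query o adj K L e`: the space is split as `ℂ^S = (ℂ^(Q o) ⊗ ℂ^K) ⊕ ℂ^L`; the black box `o`
  (its adjoint if `adj = true`) acts on the register `Q o` of the first summand, and nothing
  happens on the second one. So a query may be controlled on other registers. -/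
inductive Gate {Idx : Type} (Q : Idx → Type) (S : Type) [Fintype S] [DecidableEq S] : Type 1
  | free (U : Matrix.unitaryGroup S ℂ) : Gate Q S
  | query (o : Idx) (adj : Bool) (K L : Type)
      (e : S ≃ (Q o × K) ⊕ L) : Gate Q S

open Classical in
/-- The operator of a gate, when the black boxes are the operators `F o`. -/
def Gate.eval {Idx : Type} {Q : Idx → Type} {S : Type} [Fintype S] [DecidableEq S]
    (F : ∀ o, Matrix (Q o) (Q o) ℂ) : Gate Q S → Matrix S S ℂ
  | .free U => U.1
  | .query o adj K L e =>
      Matrix.reindex e.symm e.symm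
        (Matrix.fromBlocks ((if adj then (F o)ᴴ else F o) ⊗ₖ (1 : Matrix K K ℂ)) 0 0
          (1 : Matrix L L ℂ))

/-- Whether a gate is a query. -/
def Gate.isQuery {Idx : Type} {Q : Idx → Type} {S : Type} [Fintype S] [DecidableEq S] :
    Gate Q S → Bool
  | .free _ => false
  | .query _ _ _ _ _ => true

/-- A circuit is a list of gates; the head of the list is applied first. -/
abbrev Circuit {Idx : Type} (Q : Idx → Type) (S : Type) [Fintype S] [DecidableEq S] : Type 1 :=
  List (Gate Q S)

/-- The operator of a circuit. -/
def Circuit.eval {Idx : Type} {Q : Idx → Type} {S : Type} [Fintype S] [DecidableEq S]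
    (F : ∀ o, Matrix (Q o) (Q o) ℂ) : Circuit Q S → Matrix S S ℂ
  | [] => 1
  | g :: gs => Circuit.eval F gs * g.eval F

/-- The number of applications of black boxes (or of their adjoints) in a circuit. -/
def Circuit.queryCount {Idx : Type} {Q : Idx → Type} {S : Type} [Fintype S] [DecidableEq S]
    (c : Circuit Q S) : ℕ :=
  List.countP Gate.isQuery c

/-! ## Computation trees -/

/-- `AtDist rel r n x`: there is a chain of `n` steps of `rel` from `r` to `x`. -/
inductive AtDist {X : Type} (rel : X → X → Prop) (r : X) : ℕ → X → Prop
  | zero : AtDist rel r 0 r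
  | succ {n : ℕ} {x y : X} : AtDist rel r n x → rel x y → AtDist rel r (n + 1) y

/-- The distance from the root `r` to `x` along the child relation `rel`. -/
def distFrom {X : Type} (rel : X → X → Prop) (r x : X) : ℕ := sInf {n | AtDist rel r n x}

/-- A computation tree on the vertex set `V`: a rooted tree in which the children of each vertex
are indexed, with the transition time `time v` from the parent of `v` to `v`, and with
some of the leaves marked. -/
structure ComputationTree (V : Type) where
  root : V
  deg : V → ℕ
  child : ∀ u : V, Fin (deg u) → V
  /-- a vertex is a child of at most one vertex, and at one index only -/
  child_injective : Function.Injective fun p : (Σ u : V, Fin (deg u)) => child p.1 p.2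
  child_ne_root : ∀ u i, child u i ≠ root
  /-- every vertex is a descendant of the root -/
  reach : ∀ v, ∃ n, AtDist (fun u v => ∃ i, child u i = v) root n v
  time : V → ℕ
  time_root : time root = 0
  time_pos : ∀ v, v ≠ root → 0 < time v
  marked : V → Bool
  leaf_of_marked : ∀ v, marked v = true → deg v = 0

namespace ComputationTree

/-- `v` is a child of `u`. -/
def IsChild {V : Type} (T : ComputationTree V) (u v : V) : Prop := ∃ i, T.child u i = v

/-- The depth of the tree: the largest distance of a vertex from the root. -/
def depth {V : Type} [Fintype V] (T : ComputationTree V) : ℕ :=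
  Finset.univ.sup fun v => distFrom T.IsChild T.root v

/-- `∑ v, t_v ^ 2`. -/
def sqTime {V : Type} [Fintype V] (T : ComputationTree V) : ℕ := ∑ v, T.time v ^ 2

/-- `max_v t_v`. -/
def maxTime {V : Type} [Fintype V] (T : ComputationTree V) : ℕ := Finset.univ.sup T.time

/-- The largest number of children of a vertex. -/
def maxDeg {V : Type} [Fintype V] (T : ComputationTree V) : ℕ := Finset.univ.sup T.deg

/-! ## The quantum walk

The transition to `v` is run in blocks of `1, 2, 4, …` steps, up to the first block by whose end
`v` has been computed. -/

/-- The number of walk vertices on the edge to `v`: the least number `1 + 2 + ⋯ + 2 ^ a` that is at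
least `t_v` (for `t_v > 0`). -/
def pathLen {V : Type} (T : ComputationTree V) (v : V) : ℕ := 2 ^ (Nat.log 2 (T.time v) + 1) - 1

/-- The expanded tree: `none` is the root, and `some ⟨v, j⟩` is the vertex `s(v, j + 1)` reached
after `j + 1` steps of the transition to `v`. -/
abbrev Expanded {V : Type} (T : ComputationTree V) : Type :=
  Option (Σ v : {v : V // v ≠ T.root}, Fin (T.pathLen v))

/-- The child relation of the expanded tree. -/
def ExpChild {V : Type} (T : ComputationTree V) : T.Expanded → T.Expanded → Prop
  | _, none => False
  | none, some ⟨v, j⟩ => T.IsChild T.root v ∧ j.val = 0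
  | some ⟨u, i⟩, some ⟨v, j⟩ =>
      (u = v ∧ j.val = i.val + 1) ∨ (i.val + 1 = T.pathLen u ∧ T.IsChild u v ∧ j.val = 0)

/-- The marked vertices of the expanded tree: the ends of the transitions to marked vertices. -/
def ExpMarked {V : Type} (T : ComputationTree V) : T.Expanded → Prop
  | none => T.marked T.root = true
  | some ⟨v, j⟩ => j.val + 1 = T.pathLen v ∧ T.marked v = true

/-- The weights. The steps of a block of length `2 ^ i` have weight `2 ^ i`, and the root has weight
`1 / (D (⌊log₂ τ⌋ + 1))`, where `D` and `τ` are bounds for the depth and the transition times: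
a path from the root to a vertex of the tree contains at most `D (⌊log₂ τ⌋ + 1)` blocks. -/
def weight {V : Type} (T : ComputationTree V) (D τ : ℕ) : T.Expanded → ℝ
  | none => 1 / ((D : ℝ) * ((Nat.log 2 τ : ℝ) + 1))
  | some ⟨_, j⟩ => 2 ^ Nat.log 2 (j.val + 1)

open Classical in
/-- The unnormalised star state `√w_x |x⟩ + ∑_{y child of x} √w_y |y⟩`. -/
def starVec {V : Type} (T : ComputationTree V) (D τ : ℕ) (x y : T.Expanded) : ℝ :=
  if y = x ∨ T.ExpChild x y then √(T.weight D τ y) else 0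

/-- The projector `|ψ_x⟩⟨ψ_x|` on the normalised star state. -/
def starProj {V : Type} [Fintype V] [DecidableEq V] (T : ComputationTree V) (D τ : ℕ)
    (x : T.Expanded) : Matrix T.Expanded T.Expanded ℂ :=
  Matrix.of fun y z =>
    ((T.starVec D τ x y * T.starVec D τ x z / ∑ y', T.starVec D τ x y' ^ 2 : ℝ) : ℂ)

open Classical in
/-- The direct sum of the diffusion operators `D_x` over the vertices `x` whose distance from the
root has parity `p`. Here `D_x` is the identity if `x` is marked and `1 - 2 |ψ_x⟩⟨ψ_x|` otherwise.
The stars of two vertices of the same parity are disjoint; basis states outside all of them (which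
is the root, for `p = 1`) are fixed. -/
def diffusion {V : Type} [Fintype V] [DecidableEq V] (T : ComputationTree V) (D τ : ℕ) (p : ℕ) :
    Matrix T.Expanded T.Expanded ℂ :=
  1 - (2 : ℂ) • ∑ x : T.Expanded,
    if ¬ T.ExpMarked x ∧ distFrom T.ExpChild none x % 2 = p then T.starProj D τ x else 0

/-- The step `U = R_B R_A` of the quantum walk. -/
def walkStep {V : Type} [Fintype V] [DecidableEq V] (T : ComputationTree V) (D τ : ℕ) :
    Matrix T.Expanded T.Expanded ℂ :=
  T.diffusion D τ 1 * T.diffusion D τ 0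

end ComputationTree

/-! ## The oracles

`B` is the basis of the work register, which holds descriptions of vertices; index registers and
degree registers hold numbers up to `Δ`, and time registers hold numbers up to `τ`. -/

/-- The names of the four oracles. -/
inductive OracleName
  | degree
  | mark
  | step
  | finished

/-- The registers on which the oracles act. -/
abbrev OracleReg (B : Type) (Δ τ : ℕ) : OracleName → Type
  | .degree => B × Fin (Δ + 1)
  | .mark => B × Bool
  | .step => B × Fin (Δ + 1) × B × Fin (τ + 1)
  | .finished => B × Fin (Δ + 1) × B × Fin (τ + 1) × Bool

/-- The four oracles `C`, `M`, `A` and `O_f`. -/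
structure Oracles (B : Type) (Δ τ : ℕ) where
  degree : Matrix (B × Fin (Δ + 1)) (B × Fin (Δ + 1)) ℂ
  mark : Matrix (B × Bool) (B × Bool) ℂ
  step : Matrix (B × Fin (Δ + 1) × B × Fin (τ + 1)) (B × Fin (Δ + 1) × B × Fin (τ + 1)) ℂ
  finished : Matrix (B × Fin (Δ + 1) × B × Fin (τ + 1) × Bool)
    (B × Fin (Δ + 1) × B × Fin (τ + 1) × Bool) ℂ

/-- The oracles as a family of operators. -/
def Oracles.family {B : Type} {Δ τ : ℕ} (O : Oracles B Δ τ) :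
    ∀ o, Matrix (OracleReg B Δ τ o) (OracleReg B Δ τ o) ℂ
  | .degree => O.degree
  | .mark => O.mark
  | .step => O.step
  | .finished => O.finished

/-- The state `|u⟩|i⟩|φ⟩|t⟩`, where `φ` is a state of the work register. -/
def stepKet {B : Type} [DecidableEq B] {Δ τ : ℕ} (u : B) (i : ℕ) (φ : B → ℂ) (t : ℕ) :
    B × Fin (Δ + 1) × B × Fin (τ + 1) → ℂ :=
  fun q => ket u q.1 * ket (Fin.ofNat (Δ + 1) i) q.2.1 * φ q.2.2.1 *
    ket (Fin.ofNat (τ + 1) t) q.2.2.2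

/-- The state `|u⟩|i⟩|φ⟩|t⟩|b⟩`, where `φ` is a state of the work register. -/
def finishedKet {B : Type} [DecidableEq B] {Δ τ : ℕ} (u : B) (i : ℕ) (φ : B → ℂ) (t : ℕ)
    (b : Bool) : B × Fin (Δ + 1) × B × Fin (τ + 1) × Bool → ℂ :=
  fun q => ket u q.1 * ket (Fin.ofNat (Δ + 1) i) q.2.1 * φ q.2.2.1 *
    ket (Fin.ofNat (τ + 1) t) q.2.2.2.1 * ket b q.2.2.2.2

/-- The oracles are unitary and give access to the tree `T`, where `desc v` is the description of
the vertex `v`, and `b₀` is the blank state of the work register. For a child `v` of `u`,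
`work v t` is the state `|v_t⟩` of the work register after `t` steps of the transition from
`u` to `v`. Nothing is required of the oracles on other inputs. -/
structure Oracles.Access {B : Type} [Fintype B] [DecidableEq B] {Δ τ : ℕ} (O : Oracles B Δ τ)
    (b₀ : B) {V : Type} (T : ComputationTree V) (desc : V ↪ B) (work : V → ℕ → B → ℂ) :
    Prop where
  unitary_degree : O.degree ∈ Matrix.unitaryGroup (B × Fin (Δ + 1)) ℂ
  unitary_mark : O.mark ∈ Matrix.unitaryGroup (B × Bool) ℂ
  unitary_step : O.step ∈ Matrix.unitaryGroup (B × Fin (Δ + 1) × B × Fin (τ + 1)) ℂ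
  unitary_finished :
    O.finished ∈ Matrix.unitaryGroup (B × Fin (Δ + 1) × B × Fin (τ + 1) × Bool) ℂ
  degree_apply : ∀ v, O.degree *ᵥ ket (desc v, Fin.ofNat (Δ + 1) 0) =
    ket (desc v, Fin.ofNat (Δ + 1) (T.deg v))
  mark_apply : ∀ v, O.mark *ᵥ ket (desc v, false) = ket (desc v, T.marked v)
  work_zero : ∀ v, v ≠ T.root → work v 0 = ket b₀
  work_time : ∀ v, v ≠ T.root → work v (T.time v) = ket (desc v)
  step_apply : ∀ (u : V) (i : Fin (T.deg u)) (t : ℕ), t < T.time (T.child u i) →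
    O.step *ᵥ stepKet (desc u) i (work (T.child u i) t) t =
      stepKet (desc u) i (work (T.child u i) (t + 1)) (t + 1)
  finished_apply : ∀ (u : V) (i : Fin (T.deg u)) (t : ℕ), t ≤ T.time (T.child u i) →
    O.finished *ᵥ finishedKet (desc u) i (work (T.child u i) t) t false =
      finishedKet (desc u) i (work (T.child u i) t) t (decide (T.time (T.child u i) ≤ t))

/-! ## Detection algorithms -/

/-- A two-level quantum query algorithm: a circuit `walk` on the space `S` that queries the four
oracles, and a circuit `main` on the space `X` that uses the operator of `walk` as its black box.
The algorithm starts `main` in the basis state `start`, measures in the computational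
basis at the end, and accepts if the outcome lies in `accept`. -/
structure DetectionAlgorithm (B : Type) (Δ τ : ℕ) where
  S : Type
  [fintypeS : Fintype S]
  [decEqS : DecidableEq S]
  /-- the subroutine for one step of the quantum walk -/
  walk : Circuit (OracleReg B Δ τ) S
  /-- the basis state that encodes the root -/
  rootState : S
  X : Type
  [fintypeX : Fintype X]
  [decEqX : DecidableEq X]
  main : Circuit (fun _ : Unit => S) X
  start : X
  accept : Finset X

attribute [instance] DetectionAlgorithm.fintypeS DetectionAlgorithm.decEqS
  DetectionAlgorithm.fintypeX DetectionAlgorithm.decEqX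

namespace DetectionAlgorithm

/-- The operator that `walk` computes with the oracles `O`. -/
def walkOp {B : Type} {Δ τ : ℕ} (alg : DetectionAlgorithm B Δ τ) (O : Oracles B Δ τ) :
    Matrix alg.S alg.S ℂ :=
  Circuit.eval O.family alg.walk

/-- The probability that the algorithm accepts with the oracles `O`. -/
def acceptProb {B : Type} {Δ τ : ℕ} (alg : DetectionAlgorithm B Δ τ) (O : Oracles B Δ τ) : ℝ :=
  ∑ x ∈ alg.accept,
    ‖(Circuit.eval (fun _ : Unit => alg.walkOp O) alg.main *ᵥ ket alg.start) x‖ ^ 2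

/-- With the oracles `O`, the subroutine `walk` implements the operator `U`: an isometric encoding,
which maps the basis state `r` to `rootState`, intertwines `U` with the operator of `walk`. -/
def ImplementsWalk {B : Type} {Δ τ : ℕ} (alg : DetectionAlgorithm B Δ τ) (O : Oracles B Δ τ)
    {E : Type} [Fintype E] [DecidableEq E] (U : Matrix E E ℂ) (r : E) : Prop :=
  ∃ enc : Matrix alg.S E ℂ,
    encᴴ * enc = 1 ∧ enc *ᵥ ket r = ket alg.rootState ∧ alg.walkOp O * enc = enc * U

end DetectionAlgorithm

end

/-!
The algorithm estimates how much of `|r⟩` lies in the `1`-eigenspace of the walk step `U`: it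
prepares an exponent register in the uniform superposition of `0, …, n`, applies `U` as many times
as this register says, and measures whether the exponent register is in the uniform superposition
again. The acceptance probability is the squared norm of the average of `U ^ k |r⟩` over `k ≤ n`
(`averageCircuit_apply`), and two runs raise the gap between the two cases (`acceptance_twice`).

If there is no marked vertex, put `a = ∑ x, √w_x |x⟩`. Every star of the tree is reflected in the
direction of the restriction of `a`, so that each factor of `U` only flips the sign of `a`, apart
from the root, which `R_B` fixes. Hence `(1 - U) a = 2 √w_r |r⟩`
(`ComputationTree.sub_walkStep_mulVec_sqrt_weight`), the average telescopes, and its squared norm is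
at most `(∑ x, w_x) / (w_r (n + 1)²)` (`averageNormSq_le`). The total weight is `O(T)`, since each
path that replaces an edge has less than `2 t_v` vertices, of weights at most `t_v`
(`ComputationTree.sum_weight_le`); so `n = O(√(T D log t_max))` powers are enough.

If a vertex is marked, take the path from the root to it. The vector with the entries `± 1 / √w_x`
along this path, with alternating signs, is orthogonal to every star vector but that of the end of
the path, where `D_x = I`, and is therefore fixed by `U`. Each level of `𝒯` contributes at most
`⌊log₂ t_max⌋ + 1` to its squared norm, one for each dyadic block of weights, so that the root
carries at least half of it (`ComputationTree.exists_invariant`). Overlaps with invariant vectors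
survive the averaging (`averageNormSq_ge`).

The subroutine for `U` stores a vertex of the expanded tree as the stack of its ancestors in `𝒯`,
its position on the path of the current edge, and the state of the work register after that many
steps. The star of a vertex is gathered onto one place, with a slot register that tells which
element of the star is meant (`ComputationTree.gatherCircuit_encState`). There the oracles supply
the degree, the mark, and whether the path ends here, which determine the amplitudes of the star
vector on the slot register; a reflection of the slot register controlled by these answers is `D_x`
(`ComputationTree.diffusionCircuit_encState`).
-/

noncomputable section

/-! ### Basis states, superpositions and product states -/

section Kets

variable {ι κ ρ : Type}

theorem ket_apply [DecidableEq ι] (i j : ι) : ket i j = if j = i then 1 else 0 := by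
  simp [ket, Pi.single_apply]

theorem mulVec_ket [Fintype ι] [DecidableEq ι] (M : Matrix κ ι ℂ) (i : ι) :
    M *ᵥ ket i = fun s => M s i := by
  ext s; simp [ket]

/-- The superposition `∑ i, φ i |f i⟩`. -/
def spread [Fintype ι] [DecidableEq κ] (f : ι → κ) (φ : ι → ℂ) : κ → ℂ := ∑ i, φ i • ket (f i)

theorem spread_apply [Fintype ι] [DecidableEq κ] (f : ι → κ) (φ : ι → ℂ) (s : κ) :
    spread f φ s = ∑ i, φ i * if s = f i then 1 else 0 := by
  simp [spread, Finset.sum_apply, ket_apply]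

theorem spread_ket [Fintype ι] [DecidableEq ι] [DecidableEq κ] (f : ι → κ) (i : ι) :
    spread f (ket i) = ket (f i) := by
  ext s; rw [spread_apply, Finset.sum_eq_single i] <;> simp +contextual [ket_apply]

theorem mulVec_spread [Fintype ι] [Fintype κ] [DecidableEq κ] (M : Matrix κ κ ℂ) (f : ι → κ)
    (φ : ι → ℂ) : M *ᵥ spread f φ = ∑ i, φ i • M *ᵥ ket (f i) := by
  simp [spread, Matrix.mulVec_sum, Matrix.mulVec_smul]

/-- The product of the state `φ` of the register `κ` with a basis state of the rest, for a
splitting of a basis into a register and the rest. -/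
def prodKet {σ : Type} [DecidableEq ρ] (r : σ ≃ κ × ρ) (φ : κ → ℂ) (x : ρ) : σ → ℂ :=
  fun s => φ (r s).1 * ket x (r s).2

theorem spread_eq_prodKet [Fintype ι] [DecidableEq κ] [DecidableEq ρ] {σ : Type} [DecidableEq σ]
    (r : σ ≃ κ × ρ) (f : ι → σ) (φ : ι → ℂ) (g : ι → κ) (x : ρ) (h : ∀ i, r (f i) = (g i, x)) :
    spread f φ = prodKet r (spread g φ) x := by
  ext s
  simp only [prodKet, spread_apply, ket_apply, Finset.sum_mul]
  refine Finset.sum_congr rfl fun i _ => ?_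
  have : s = f i ↔ (r s).1 = g i ∧ (r s).2 = x := by
    rw [← r.apply_eq_iff_eq, h, Prod.ext_iff]
  by_cases h1 : (r s).1 = g i <;> by_cases h2 : (r s).2 = x <;> simp [this, h1, h2]

/-- Superpositions over disjoint families of basis states are orthogonal. -/
theorem spread_orthogonal [Fintype ι] [Fintype κ] [DecidableEq κ] (f g : ι → κ) (φ ψ : ι → ℂ)
    (h : ∀ i j, f i ≠ g j) : star (spread f φ) ⬝ᵥ spread g ψ = 0 := by
  rw [dotProduct]
  refine Finset.sum_eq_zero fun s _ => ?_
  rw [Pi.star_apply, spread_apply, spread_apply]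
  by_cases hs : ∃ i, s = f i
  · obtain ⟨i, rfl⟩ := hs
    simp [h]
  · push Not at hs
    simp [hs]

theorem spread_inner [Fintype ι] [Fintype κ] [DecidableEq κ] (f : ι → κ)
    (hf : Function.Injective f) (φ ψ : ι → ℂ) : star (spread f φ) ⬝ᵥ spread f ψ = star φ ⬝ᵥ ψ := by
  have hval : ∀ (χ : ι → ℂ) i, spread f χ (f i) = χ i := fun χ i => by
    rw [spread_apply, Finset.sum_eq_single i] <;> simp +contextual [hf.eq_iff, eq_comm]
  rw [dotProduct, dotProduct, ← Finset.sum_subset (Finset.subset_univ (Finset.univ.image f)),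
    Finset.sum_image hf.injOn]
  · simp [hval]
  · intro s _ hs
    have : ∀ i, s ≠ f i := fun i hi => hs (by simp [hi])
    simp [spread_apply, this]

end Kets

/-! ### Gates and circuits -/

/-- A partial injection of a finite type extends to a permutation. -/
theorem exists_perm_of_injOn {S : Type} [Finite S] (A : Set S) (f : S → S) (hf : Set.InjOn f A) :
    ∃ σ : Equiv.Perm S, ∀ s ∈ A, σ s = f s := by
  classical
  have := Fintype.ofFinite S
  let e : {x // x ∈ A} ≃ {x // x ∈ f '' A} := Equiv.Set.imageOfInjOn f A hf
  exact ⟨e.extendSubtype, fun s hs => e.extendSubtype_apply_of_mem s hs⟩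

section Circuits

variable {Idx : Type} {Q : Idx → Type} {S : Type} [Fintype S] [DecidableEq S]

/-- The adjoint gate. -/
def Gate.inv : Gate Q S → Gate Q S
  | .free U => .free U⁻¹
  | .query o adj K L e => .query o (!adj) K L e

/-- The circuit that runs `c` backwards. -/
def Circuit.inv (c : Circuit Q S) : Circuit Q S := (c.map Gate.inv).reverse

theorem Gate.eval_inv (F : ∀ o, Matrix (Q o) (Q o) ℂ) (g : Gate Q S) :
    g.inv.eval F = (g.eval F)ᴴ := by
  classical
  cases g with
  | free U => rfl
  | query o adj K L e =>
    simp only [Gate.inv, Gate.eval]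
    rw [Matrix.conjTranspose_reindex, Matrix.fromBlocks_conjTranspose]
    simp only [Matrix.conjTranspose_kronecker, Matrix.conjTranspose_one, Matrix.conjTranspose_zero]
    cases adj <;> simp

theorem Circuit.eval_append (F : ∀ o, Matrix (Q o) (Q o) ℂ) (c d : Circuit Q S) :
    Circuit.eval F (c ++ d) = Circuit.eval F d * Circuit.eval F c := by
  induction c with
  | nil => simp [Circuit.eval]
  | cons g c ih => simp [Circuit.eval, ih, Matrix.mul_assoc]

theorem Circuit.eval_inv (F : ∀ o, Matrix (Q o) (Q o) ℂ) (c : Circuit Q S) :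
    Circuit.eval F c.inv = (Circuit.eval F c)ᴴ := by
  induction c with
  | nil => simp [Circuit.inv, Circuit.eval]
  | cons g c ih =>
    have : Circuit.inv (g :: c) = Circuit.inv c ++ [g.inv] := by simp [Circuit.inv]
    rw [this, Circuit.eval_append, ih]
    simp [Circuit.eval, Gate.eval_inv]

theorem Circuit.queryCount_append (c d : Circuit Q S) :
    Circuit.queryCount (c ++ d) = c.queryCount + d.queryCount := by
  simp [Circuit.queryCount]

theorem Circuit.queryCount_inv (c : Circuit Q S) : c.inv.queryCount = c.queryCount := by
  have h : (Gate.isQuery ∘ Gate.inv : Gate Q S → Bool) = Gate.isQuery := by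
    ext g; cases g <;> rfl
  simp [Circuit.queryCount, Circuit.inv, List.countP_map, h]

theorem Gate.eval_mem_unitary [∀ o, Fintype (Q o)] [∀ o, DecidableEq (Q o)] [∀ o, Nonempty (Q o)]
    (F : ∀ o, Matrix (Q o) (Q o) ℂ) (hF : ∀ o, F o ∈ Matrix.unitaryGroup (Q o) ℂ) (g : Gate Q S) :
    g.eval F ∈ Matrix.unitaryGroup S ℂ := by
  classical
  cases g with
  | free U => exact U.2
  | query o adj K L e =>
    have : Finite K := by
      obtain ⟨q⟩ := (inferInstance : Nonempty (Q o))
      exact Finite.of_injective (fun k : K => e.symm (Sum.inl (q, k))) fun a b h => by simpa using h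
    have : Finite L :=
      Finite.of_injective (fun l : L => e.symm (Sum.inr l)) fun a b h => by simpa using h
    have := Fintype.ofFinite K
    have := Fintype.ofFinite L
    have hG : ∀ G ∈ Matrix.unitaryGroup (Q o) ℂ,
        Matrix.reindex e.symm e.symm (Matrix.fromBlocks (G ⊗ₖ (1 : Matrix K K ℂ)) 0 0
          (1 : Matrix L L ℂ)) ∈ Matrix.unitaryGroup S ℂ := by
      intro G h
      rw [Matrix.mem_unitaryGroup_iff'] at h ⊢
      rw [Matrix.star_eq_conjTranspose] at h ⊢
      rw [Matrix.conjTranspose_reindex, Matrix.fromBlocks_conjTranspose]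
      simp only [Matrix.reindex_apply, Matrix.submatrix_mul_equiv, Matrix.fromBlocks_multiply,
        Matrix.conjTranspose_kronecker, ← Matrix.mul_kronecker_mul, h]
      simp
    have key : (if adj then (F o)ᴴ else F o) ∈ Matrix.unitaryGroup (Q o) ℂ := by
      split
      · exact Unitary.star_mem (hF o)
      · exact hF o
    have := hG _ key
    unfold Gate.eval
    convert this

theorem Circuit.eval_mem_unitary [∀ o, Fintype (Q o)] [∀ o, DecidableEq (Q o)]
    [∀ o, Nonempty (Q o)] (F : ∀ o, Matrix (Q o) (Q o) ℂ)
    (hF : ∀ o, F o ∈ Matrix.unitaryGroup (Q o) ℂ) (c : Circuit Q S) :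
    Circuit.eval F c ∈ Matrix.unitaryGroup S ℂ := by
  induction c with
  | nil => exact one_mem _
  | cons g c ih => exact mul_mem ih (g.eval_mem_unitary F hF)

theorem mulVec_conjTranspose_of_unitary {M : Matrix S S ℂ} (hM : M ∈ Matrix.unitaryGroup S ℂ)
    {u v : S → ℂ} (h : M *ᵥ u = v) : Mᴴ *ᵥ v = u := by
  rw [Matrix.mem_unitaryGroup_iff', Matrix.star_eq_conjTranspose] at hM
  rw [← h, Matrix.mulVec_mulVec, hM, Matrix.one_mulVec]

/-- The permutation of basis states as a gate. -/
def permGate (σ : Equiv.Perm S) : Gate Q S :=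
  .free ⟨Matrix.of fun a b => if a = σ b then 1 else 0, by
    rw [Matrix.mem_unitaryGroup_iff']
    ext a b
    simp [Matrix.mul_apply, Matrix.star_apply, Matrix.one_apply, eq_comm]⟩

theorem permGate_ket (F : ∀ o, Matrix (Q o) (Q o) ℂ) (σ : Equiv.Perm S) (s : S) :
    (permGate σ : Gate Q S).eval F *ᵥ ket s = ket (σ s) := by
  rw [mulVec_ket]; ext a; simp [permGate, Gate.eval, ket_apply]

theorem permGate_spread {ι : Type} [Fintype ι] [DecidableEq ι] (F : ∀ o, Matrix (Q o) (Q o) ℂ)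
    (σ : Equiv.Perm S) (f : ι → S) (φ : ι → ℂ) :
    (permGate σ : Gate Q S).eval F *ᵥ spread f φ = spread (fun i => σ (f i)) φ := by
  rw [mulVec_spread]; simp only [permGate_ket]; rfl

/-- The query of the black box `o` (of its adjoint if `adj = true`) on the register `Q o` of a
product basis, controlled on the property `P` of the rest. -/
def ctrlQuery {R : Type} (o : Idx) (adj : Bool) (r : S ≃ Q o × R) (P : R → Prop) : Gate Q S :=
  open Classical in
  .query o adj {x // P x} (Q o × {x // ¬ P x})
    ((r.trans ((Equiv.refl _).prodCongr (Equiv.sumCompl P).symm)).trans (Equiv.prodSumDistrib ..))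

theorem ctrlQuery_mulVec {R : Type} [∀ o, Fintype (Q o)] (F : ∀ o, Matrix (Q o) (Q o) ℂ)
    (o : Idx) (adj : Bool) (r : S ≃ Q o × R) (P : R → Prop) (ψ : S → ℂ) (s : S) :
    open Classical in
    ((ctrlQuery o adj r P : Gate Q S).eval F *ᵥ ψ) s =
      if P (r s).2 then ∑ q, (if adj then (F o)ᴴ else F o) (r s).1 q * ψ (r.symm (q, (r s).2))
      else ψ s := by
  classical
  have hent : ∀ s s', (ctrlQuery o adj r P : Gate Q S).eval F s s' =
      if (r s).2 = (r s').2 then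
        if P (r s).2 then (if adj then (F o)ᴴ else F o) (r s).1 (r s').1
        else if (r s).1 = (r s').1 then 1 else 0
      else 0 := by
    intro s s'
    simp only [ctrlQuery, Gate.eval, Matrix.reindex_apply, Matrix.submatrix_apply]
    rcases h : r s with ⟨q, x⟩
    rcases h' : r s' with ⟨q', x'⟩
    by_cases hx : P x <;> by_cases hx' : P x'
    · simp [h, h', hx, hx', Matrix.kroneckerMap_apply, Matrix.one_apply]
    · have : x ≠ x' := fun h => hx' (h ▸ hx)
      simp [h, h', hx, hx', this]
    · have : x ≠ x' := fun h => hx (h ▸ hx')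
      simp [h, h', hx, hx', this]
    · by_cases hq : q = q' <;> by_cases hxx : x = x' <;>
        simp [h, h', hx, hx', hq, hxx]
  have hsum : ((ctrlQuery o adj r P : Gate Q S).eval F *ᵥ ψ) s =
      ∑ s', (ctrlQuery o adj r P : Gate Q S).eval F s s' * ψ s' := rfl
  rw [hsum]
  generalize (if adj then (F o)ᴴ else F o) = G at hent ⊢
  split_ifs with hP
  · rw [← Finset.sum_subset
      (Finset.subset_univ (Finset.univ.image fun q => r.symm (q, (r s).2))), Finset.sum_image]
    · simp [hent, hP]
    · intro a _ b _ h; simpa using h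
    · intro s' _ hs'
      have : (r s).2 ≠ (r s').2 := fun h => hs' (by
        simp only [Finset.mem_image, Finset.mem_univ, true_and]
        exact ⟨(r s').1, by simp [h]⟩)
      simp [hent, this]
  · rw [Finset.sum_eq_single s]
    · simp [hent, hP]
    · intro s' _ hs'
      rw [hent, if_neg hP]
      split_ifs with h1 h2
      · exact absurd (r.injective (Prod.ext h2 h1)) hs'.symm
      · simp
      · simp
    · simp

theorem ctrlQuery_prodKet {R : Type} [DecidableEq R] [∀ o, Fintype (Q o)]
    (F : ∀ o, Matrix (Q o) (Q o) ℂ) (o : Idx) (adj : Bool)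
    (r : S ≃ Q o × R) (P : R → Prop) (φ : Q o → ℂ) (x : R) (hx : P x) :
    (ctrlQuery o adj r P : Gate Q S).eval F *ᵥ prodKet r φ x =
      prodKet r ((if adj then (F o)ᴴ else F o) *ᵥ φ) x := by
  ext s
  rw [ctrlQuery_mulVec]
  by_cases h : (r s).2 = x
  · simp [prodKet, h, hx, ket_apply, Matrix.mulVec, dotProduct]
  · simp [prodKet, h, ket_apply]

theorem ctrlQuery_spread {R ι : Type} [∀ o, Fintype (Q o)] [∀ o, DecidableEq (Q o)] [Fintype ι]
    (F : ∀ o, Matrix (Q o) (Q o) ℂ) (o : Idx) (adj : Bool) (r : S ≃ Q o × R) (P : R → Prop)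
    {f f' : ι → S} {φ φ' : ι → ℂ} (g g' : ι → Q o) (x : R) (hx : P x)
    (hf : ∀ i, r (f i) = (g i, x)) (hf' : ∀ i, r (f' i) = (g' i, x))
    (h : (if adj then (F o)ᴴ else F o) *ᵥ spread g φ = spread g' φ') :
    (ctrlQuery o adj r P : Gate Q S).eval F *ᵥ spread f φ = spread f' φ' := by
  classical
  rw [spread_eq_prodKet r f φ g x hf, ctrlQuery_prodKet F o adj r P _ x hx, h,
    spread_eq_prodKet r f' φ' g' x hf']

theorem ctrlQuery_spread_of_not {R ι : Type} [∀ o, Fintype (Q o)] [∀ o, DecidableEq (Q o)]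
    [Fintype ι] (F : ∀ o, Matrix (Q o) (Q o) ℂ) (o : Idx) (adj : Bool) (r : S ≃ Q o × R)
    (P : R → Prop) {f : ι → S} {φ : ι → ℂ} (h : ∀ i, ¬ P (r (f i)).2) :
    (ctrlQuery o adj r P : Gate Q S).eval F *ᵥ spread f φ = spread f φ := by
  ext s
  rw [ctrlQuery_mulVec]
  generalize (if adj then (F o)ᴴ else F o) = G
  split_ifs with hs
  · have hz : ∀ q, spread f φ (r.symm (q, (r s).2)) = 0 := fun q => by
      rw [spread_apply]
      refine Finset.sum_eq_zero fun i _ => ?_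
      rw [if_neg, mul_zero]
      intro h'
      have := h i
      rw [← h'] at this
      exact this (by simpa using hs)
    have := hz (r s).1
    simp only [Prod.mk.eta, Equiv.symm_apply_apply] at this
    simp [hz, this]
  · rfl

/-- The Householder reflection `1 - 2 |a⟩⟨a| / ‖a‖²` for a real vector `a`; the identity if
`a = 0`. -/
def householder {C : Type} [Fintype C] [DecidableEq C] (a : C → ℝ) : Matrix C C ℂ :=
  1 - (2 : ℂ) • Matrix.of fun c d => ((a c * a d / ∑ e, a e ^ 2 : ℝ) : ℂ)

theorem householder_mem_unitary {C : Type} [Fintype C] [DecidableEq C] (a : C → ℝ) :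
    householder a ∈ Matrix.unitaryGroup C ℂ := by
  set P : Matrix C C ℂ := Matrix.of fun c d => ((a c * a d / ∑ e, a e ^ 2 : ℝ) : ℂ) with hP
  have hstar : star P = P := by
    ext c d
    simp only [hP, Matrix.star_apply, Matrix.of_apply, RCLike.star_def, Complex.conj_ofReal,
      mul_comm]
  have hsq : P * P = P := by
    ext c d
    simp only [hP, Matrix.mul_apply, Matrix.of_apply]
    norm_cast
    by_cases h : ∑ e, a e ^ 2 = 0
    · simp [h]
    · have : ∀ e, a c * a e / (∑ e, a e ^ 2) * (a e * a d / ∑ e, a e ^ 2) =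
          a e ^ 2 * (a c * a d / (∑ e, a e ^ 2) ^ 2) := fun e => by ring
      simp only [this]
      rw [← Finset.sum_mul]
      field_simp
  rw [Matrix.mem_unitaryGroup_iff', householder, ← hP, star_sub, star_smul, hstar]
  simp only [star_one, star_ofNat, sub_mul, mul_sub, one_mul, mul_one, smul_mul_smul_comm, hsq]
  module

end Circuits

/-! ### Squared norms -/

section Norms

variable {S : Type} [Fintype S]

theorem ofReal_sum_norm_sq (v : S → ℂ) : ((∑ s, ‖v s‖ ^ 2 : ℝ) : ℂ) = star v ⬝ᵥ v := by
  simp [dotProduct, Complex.conj_mul']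

theorem sum_norm_sq_mulVec_of_isometry {E : Type} [Fintype E] [DecidableEq E] (M : Matrix S E ℂ)
    (hM : Mᴴ * M = 1) (v : E → ℂ) : ∑ s, ‖(M *ᵥ v) s‖ ^ 2 = ∑ x, ‖v x‖ ^ 2 := by
  have h : ((∑ s, ‖(M *ᵥ v) s‖ ^ 2 : ℝ) : ℂ) = ((∑ x, ‖v x‖ ^ 2 : ℝ) : ℂ) := by
    rw [ofReal_sum_norm_sq, ofReal_sum_norm_sq, Matrix.star_mulVec, Matrix.dotProduct_mulVec,
      Matrix.vecMul_vecMul, hM, Matrix.vecMul_one]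
  exact_mod_cast h

theorem sum_norm_sq_mulVec_of_unitary [DecidableEq S] {M : Matrix S S ℂ}
    (hM : M ∈ Matrix.unitaryGroup S ℂ) (v : S → ℂ) : ∑ s, ‖(M *ᵥ v) s‖ ^ 2 = ∑ s, ‖v s‖ ^ 2 :=
  sum_norm_sq_mulVec_of_isometry M (Matrix.mem_unitaryGroup_iff'.1 hM) v

theorem sum_norm_sq_ket [DecidableEq S] (s : S) : ∑ x, ‖ket s x‖ ^ 2 = 1 := by
  rw [Finset.sum_eq_single s] <;> simp +contextual [ket_apply]

theorem sum_norm_sq_sub_le (u v : S → ℂ) :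
    ∑ s, ‖(u - v) s‖ ^ 2 ≤ 2 * ∑ s, ‖u s‖ ^ 2 + 2 * ∑ s, ‖v s‖ ^ 2 := by
  rw [Finset.mul_sum, Finset.mul_sum, ← Finset.sum_add_distrib]
  refine Finset.sum_le_sum fun s _ => ?_
  have h := norm_sub_le (u s) (v s)
  have h0 := norm_nonneg ((u - v) s)
  simp only [Pi.sub_apply] at *
  nlinarith [sq_nonneg (‖u s‖ - ‖v s‖)]

/-- The Cauchy–Schwarz inequality. -/
theorem norm_dotProduct_sq_le (u v : S → ℂ) :
    ‖u ⬝ᵥ v‖ ^ 2 ≤ (∑ s, ‖u s‖ ^ 2) * ∑ s, ‖v s‖ ^ 2 := by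
  refine le_trans ?_ (Finset.sum_mul_sq_le_sq_mul_sq Finset.univ (fun s => ‖u s‖) fun s => ‖v s‖)
  refine pow_le_pow_left₀ (norm_nonneg _) ((norm_sum_le _ _).trans_eq ?_) 2
  simp

end Norms

/-! ### Running a circuit twice -/

section Twice

variable {Idx : Type} {Q : Idx → Type} {X : Type} [Fintype X] [DecidableEq X]

/-- The gate on the first factor of a product space. -/
def Gate.onLeft (Y : Type) [Fintype Y] [DecidableEq Y] : Gate Q X → Gate Q (X × Y)
  | .free U => .free ⟨U.1 ⊗ₖ 1, Matrix.kronecker_mem_unitary U.2 (one_mem _)⟩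
  | .query o adj K L e => .query o adj (K × Y) (L × Y)
      ((e.prodCongr (Equiv.refl Y)).trans ((Equiv.sumProdDistrib _ _ _).trans
        ((Equiv.prodAssoc _ _ _).sumCongr (Equiv.refl _))))

theorem Gate.eval_onLeft (F : ∀ o, Matrix (Q o) (Q o) ℂ) (Y : Type) [Fintype Y] [DecidableEq Y]
    (g : Gate Q X) : (g.onLeft Y).eval F = g.eval F ⊗ₖ (1 : Matrix Y Y ℂ) := by
  classical
  cases g with
  | free U => rfl
  | query o adj K L e =>
    ext ⟨x, y⟩ ⟨x', y'⟩
    simp only [Gate.onLeft, Gate.eval, Matrix.reindex_apply, Matrix.submatrix_apply,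
      Matrix.kroneckerMap_apply]
    rcases h : e x with ⟨q, k⟩ | l <;> rcases h' : e x' with ⟨q', k'⟩ | l'
    · by_cases hk : k = k' <;> by_cases hy : y = y' <;>
        simp [h, h', hk, hy, Matrix.one_apply]
    · simp [h, h']
    · simp [h, h']
    · by_cases hk : l = l' <;> by_cases hy : y = y' <;>
        simp [h, h', hk, hy, Matrix.one_apply]

theorem Circuit.eval_map_onLeft (F : ∀ o, Matrix (Q o) (Q o) ℂ) (Y : Type) [Fintype Y]
    [DecidableEq Y] (c : Circuit Q X) :
    Circuit.eval F (c.map (Gate.onLeft Y)) = Circuit.eval F c ⊗ₖ (1 : Matrix Y Y ℂ) := by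
  induction c with
  | nil => simp [Circuit.eval]
  | cons g c ih =>
    simp only [List.map_cons, Circuit.eval, ih, Gate.eval_onLeft, ← Matrix.mul_kronecker_mul,
      Matrix.one_mul]

theorem kronecker_one_mulVec {X Y : Type} [Fintype X] [Fintype Y] [DecidableEq Y]
    (M : Matrix X X ℂ) (u : X → ℂ) (v : Y → ℂ) :
    (M ⊗ₖ (1 : Matrix Y Y ℂ)) *ᵥ (fun p => u p.1 * v p.2) = fun p => (M *ᵥ u) p.1 * v p.2 := by
  ext ⟨x, y⟩
  simp only [Matrix.mulVec, dotProduct, Fintype.sum_prod_type, Matrix.kroneckerMap_apply,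
    Matrix.one_apply, Finset.sum_mul]
  refine Finset.sum_congr rfl fun x' _ => ?_
  rw [Finset.sum_eq_single y] <;> simp +contextual [mul_assoc, eq_comm]

theorem one_kronecker_mulVec {Y : Type} [Fintype Y] [DecidableEq Y] (M : Matrix Y Y ℂ)
    (ψ : X × Y → ℂ) (p : X × Y) :
    (((1 : Matrix X X ℂ) ⊗ₖ M) *ᵥ ψ) p = ∑ y, M p.2 y * ψ (p.1, y) := by
  simp only [Matrix.mulVec, dotProduct, Fintype.sum_prod_type, Matrix.kroneckerMap_apply,
    Matrix.one_apply]
  rw [Finset.sum_eq_single p.1] <;> simp +contextual [eq_comm]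

/-- Two independent runs of a circuit. -/
def Circuit.twice (c : Circuit Q X) : Circuit Q (X × X) :=
  c.map (Gate.onLeft X) ++ permGate (Equiv.prodComm X X) :: c.map (Gate.onLeft X)

theorem Circuit.queryCount_twice (c : Circuit Q X) :
    c.twice.queryCount = 2 * Circuit.queryCount c := by
  have h : (Gate.isQuery ∘ Gate.onLeft X : Gate Q X → Bool) = Gate.isQuery := by
    ext g; cases g <;> rfl
  simp only [Circuit.twice, Circuit.queryCount, List.countP_append, List.countP_map, h,
    List.countP_cons, permGate, Gate.isQuery]
  simp; omega

theorem Circuit.eval_twice (F : ∀ o, Matrix (Q o) (Q o) ℂ) (c : Circuit Q X) (x : X) :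
    Circuit.eval F c.twice *ᵥ ket (x, x) =
      fun p => (Circuit.eval F c *ᵥ ket x) p.1 * (Circuit.eval F c *ᵥ ket x) p.2 := by
  have hket : (ket (x, x) : X × X → ℂ) = fun p => ket x p.1 * ket x p.2 := by
    ext ⟨a, b⟩; by_cases h1 : a = x <;> by_cases h2 : b = x <;> simp [ket_apply, h1, h2]
  have hswap : ∀ u v : X → ℂ, (permGate (Equiv.prodComm X X) : Gate Q (X × X)).eval F *ᵥ
      (fun p => u p.1 * v p.2) = fun p => v p.1 * u p.2 := by
    intro u v
    ext ⟨a, b⟩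
    simp only [permGate, Gate.eval, Matrix.mulVec, dotProduct, Matrix.of_apply]
    rw [Finset.sum_eq_single (b, a)]
    · simp [mul_comm]
    · rintro ⟨c, d⟩ _ h
      have : ¬ ((a, b) = (Equiv.prodComm X X) (c, d)) := fun h' => h (by simp_all)
      rw [if_neg this, zero_mul]
    · simp
  rw [Circuit.twice, Circuit.eval_append, Circuit.eval, Circuit.eval_map_onLeft, hket,
    ← Matrix.mulVec_mulVec, ← Matrix.mulVec_mulVec, kronecker_one_mulVec, hswap,
    kronecker_one_mulVec]

/-- If one run accepts with probability `p`, then one of two runs accepts with probability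
`1 - (1 - p) ^ 2`. -/
theorem sum_accept_twice (f : X → ℂ) (hf : ∑ x, ‖f x‖ ^ 2 = 1) (A : Finset X) :
    ∑ p ∈ (Finset.univ : Finset (X × X)).filter (fun p => p.1 ∈ A ∨ p.2 ∈ A),
      ‖f p.1 * f p.2‖ ^ 2 = 1 - (1 - ∑ x ∈ A, ‖f x‖ ^ 2) ^ 2 := by
  have h1 : ∀ B C : Finset X, ∑ p ∈ B ×ˢ C, ‖f p.1 * f p.2‖ ^ 2 =
      (∑ x ∈ B, ‖f x‖ ^ 2) * ∑ x ∈ C, ‖f x‖ ^ 2 := fun B C => by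
    rw [Finset.sum_mul_sum, Finset.sum_product]; simp [mul_pow]
  have hc : ∑ x ∈ Aᶜ, ‖f x‖ ^ 2 = 1 - ∑ x ∈ A, ‖f x‖ ^ 2 := by
    rw [← hf, ← Finset.sum_compl_add_sum A]; ring
  have h2 : (Finset.univ : Finset (X × X)).filter (fun p => p.1 ∈ A ∨ p.2 ∈ A) = (Aᶜ ×ˢ Aᶜ)ᶜ := by
    ext p; simp; tauto
  have h3 := Finset.sum_compl_add_sum (Aᶜ ×ˢ Aᶜ) fun p : X × X => ‖f p.1 * f p.2‖ ^ 2
  rw [← Finset.univ_product_univ, h1 Finset.univ, hf, h1, hc] at h3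
  rw [h2]; linarith

end Twice

/-! ### Averaging the powers of an operator -/

section Average

theorem exists_unitary_first_column (n : ℕ) :
    ∃ H ∈ Matrix.unitaryGroup (Fin (n + 1)) ℂ, ∀ k, H k 0 = ((√(n + 1 : ℝ))⁻¹ : ℝ) := by
  set u : ℝ := (√(n + 1 : ℝ))⁻¹ with hu
  have hu2 : (n + 1 : ℝ) * u ^ 2 = 1 := by
    rw [hu, inv_pow, Real.sq_sqrt (by positivity)]; field_simp
  set a : Fin (n + 1) → ℝ := fun k => (if k = 0 then 1 else 0) - u with ha
  have hsum : ∑ k, a k ^ 2 = 2 * (1 - u) := by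
    rw [Fin.sum_univ_succ]
    simp [ha, Fin.succ_ne_zero]
    nlinarith
  refine ⟨householder a, householder_mem_unitary a, fun k => ?_⟩
  have : householder a k 0 =
      (((if k = 0 then 1 else 0) - 2 * (a k * a 0 / (2 * (1 - u)))) : ℝ) := by
    simp only [householder, hsum, Matrix.sub_apply, Matrix.smul_apply, Matrix.of_apply,
      Matrix.one_apply]
    push_cast
    split_ifs <;> simp
  rw [this]
  congr 1
  by_cases h1 : u = 1
  · have hn : n = 0 := by
      have : (n : ℝ) = 0 := by rw [h1] at hu2; linarith
      exact_mod_cast this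
    subst hn
    have : k = 0 := Fin.ext (by simp)
    simp [this, h1]
  · have h0 : a 0 = 1 - u := by simp [ha]
    have : 1 - u ≠ 0 := fun h => h1 (by linarith)
    rw [h0]
    field_simp
    simp [ha]

variable {S : Type} [Fintype S] [DecidableEq S]

/-- A unitary that prepares the uniform superposition of `0, …, n`. -/
def uniformPrep (n : ℕ) : Matrix.unitaryGroup (Fin (n + 1)) ℂ :=
  ⟨(exists_unitary_first_column n).choose, (exists_unitary_first_column n).choose_spec.1⟩

theorem uniformPrep_apply (n : ℕ) (k : Fin (n + 1)) :
    (uniformPrep n).1 k 0 = ((√(n + 1 : ℝ))⁻¹ : ℝ) :=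
  (exists_unitary_first_column n).choose_spec.2 k

/-- The circuit that applies the `k`-th power of the black box for `k` in a uniform superposition of
`0, …, n`, and then returns to the original basis of the exponent register. -/
def averageCircuit (S : Type) [Fintype S] [DecidableEq S] (n : ℕ) :
    Circuit (fun _ : Unit => S) (S × Fin (n + 1)) :=
  .free ⟨1 ⊗ₖ (uniformPrep n).1, Matrix.kronecker_mem_unitary (one_mem _) (uniformPrep n).2⟩ ::
    (((List.range n).map fun j => ctrlQuery () false (Equiv.refl _) fun k => j < k.val) ++
    [.free ⟨1 ⊗ₖ (uniformPrep n)⁻¹.1,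
      Matrix.kronecker_mem_unitary (one_mem _) (uniformPrep n)⁻¹.2⟩])

theorem averageCircuit_queryCount (n : ℕ) : (averageCircuit S n).queryCount = n := by
  have h : (Gate.isQuery ∘ fun j => (ctrlQuery () false (Equiv.refl _) fun k => j < k.val :
      Gate (fun _ : Unit => S) (S × Fin (n + 1)))) = fun _ => true := by
    ext j; rfl
  simp [averageCircuit, Circuit.queryCount, List.countP_map, h, Gate.isQuery]

theorem controlled_powers (W : Matrix S S ℂ) (n m : ℕ) (s : S) (h : Fin (n + 1) → ℂ) :
    Circuit.eval (fun _ : Unit => W) ((List.range m).map fun j =>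
        (ctrlQuery () false (Equiv.refl (S × Fin (n + 1))) fun k => j < k.val)) *ᵥ
        (fun p => ket s p.1 * h p.2) =
      fun p => (W ^ min m p.2.val *ᵥ ket s) p.1 * h p.2 := by
  induction m with
  | zero => simp [Circuit.eval]
  | succ m ih =>
    rw [List.range_succ, List.map_append, Circuit.eval_append, ← Matrix.mulVec_mulVec, ih]
    ext ⟨x, k⟩
    simp only [List.map_cons, List.map_nil, Circuit.eval, one_mul]
    rw [ctrlQuery_mulVec]
    simp only [Equiv.refl_apply, Equiv.refl_symm, Bool.false_eq_true, if_false]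
    split_ifs with hk
    · rw [min_eq_left hk.le, min_eq_left (show m + 1 ≤ k.val from hk), pow_succ',
        ← Matrix.mulVec_mulVec]
      simp [Matrix.mulVec, dotProduct, Finset.sum_mul, mul_assoc]
    · rw [not_lt] at hk
      rw [min_eq_right hk, min_eq_right (by omega)]

theorem averageCircuit_apply (W : Matrix S S ℂ) (n : ℕ) (s x : S) :
    (Circuit.eval (fun _ : Unit => W) (averageCircuit S n) *ᵥ ket (s, 0)) (x, 0) =
      (((n + 1 : ℝ)⁻¹ : ℝ) • ∑ k ∈ Finset.range (n + 1), W ^ k *ᵥ ket s) x := by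
  have hprep : ((1 : Matrix S S ℂ) ⊗ₖ (uniformPrep n).1) *ᵥ ket (s, 0) =
      fun p => ket s p.1 * (((√(n + 1 : ℝ))⁻¹ : ℝ) : ℂ) := by
    ext p
    rw [one_kronecker_mulVec, Finset.sum_eq_single 0]
    · rw [uniformPrep_apply, mul_comm]; simp [ket_apply]
    · intro y _ hy; simp [ket_apply, hy]
    · simp
  rw [averageCircuit, Circuit.eval, Circuit.eval_append, ← Matrix.mulVec_mulVec,
    ← Matrix.mulVec_mulVec]
  simp only [Gate.eval, Circuit.eval, one_mul]
  rw [hprep, controlled_powers W n n s fun _ => (((√(n + 1 : ℝ))⁻¹ : ℝ) : ℂ),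
    one_kronecker_mulVec, Pi.smul_apply, Finset.sum_apply, Finset.smul_sum, Finset.sum_range]
  refine Finset.sum_congr rfl fun k _ => ?_
  have h1 : (uniformPrep n)⁻¹.1 0 k = (((√(n + 1 : ℝ))⁻¹ : ℝ) : ℂ) := by
    have : (uniformPrep n)⁻¹.1 0 k = star ((uniformPrep n).1 k 0) := rfl
    rw [this, uniformPrep_apply]; simp
  have h2 : (((n + 1 : ℝ)⁻¹ : ℝ) : ℂ) =
      (((√(n + 1 : ℝ))⁻¹ : ℝ) : ℂ) * (((√(n + 1 : ℝ))⁻¹ : ℝ) : ℂ) := by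
    rw [← Complex.ofReal_mul, ← mul_inv, Real.mul_self_sqrt (by positivity)]
  rw [h1, min_eq_right (by omega), Complex.real_smul, h2]
  ring

/-- If `(1 - W) a = b • |s⟩`, then the average of the powers `1, W, …, W ^ n` of the unitary `W`
at `|s⟩` telescopes. -/
theorem average_pow_le {W : Matrix S S ℂ} (hW : W ∈ Matrix.unitaryGroup S ℂ) (n : ℕ) (s : S)
    (a : S → ℂ) (b : ℝ) (h : a - W *ᵥ a = (b : ℂ) • ket s) :
    b ^ 2 * ∑ x, ‖(((n + 1 : ℝ)⁻¹ : ℝ) • ∑ k ∈ Finset.range (n + 1), W ^ k *ᵥ ket s) x‖ ^ 2 ≤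
      4 * (∑ x, ‖a x‖ ^ 2) / (n + 1) ^ 2 := by
  have htel : (b : ℂ) • ∑ k ∈ Finset.range (n + 1), W ^ k *ᵥ ket s = a - W ^ (n + 1) *ᵥ a := by
    rw [Finset.smul_sum]
    have : ∀ k ∈ Finset.range (n + 1), (b : ℂ) • W ^ k *ᵥ ket s =
        W ^ k *ᵥ a - W ^ (k + 1) *ᵥ a := fun k _ => by
      rw [← Matrix.mulVec_smul, ← h, Matrix.mulVec_sub, Matrix.mulVec_mulVec, ← pow_succ]
    rw [Finset.sum_congr rfl this, Finset.sum_range_sub' (fun k => W ^ k *ᵥ a)]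
    simp
  have h1 : b ^ 2 * ∑ x, ‖(((n + 1 : ℝ)⁻¹ : ℝ) • ∑ k ∈ Finset.range (n + 1),
      W ^ k *ᵥ ket s) x‖ ^ 2 = ((n + 1 : ℝ) ^ 2)⁻¹ * ∑ x, ‖(a - W ^ (n + 1) *ᵥ a) x‖ ^ 2 := by
    rw [← htel]
    simp only [Pi.smul_apply, norm_smul, mul_pow, smul_eq_mul, norm_mul, Finset.mul_sum]
    refine Finset.sum_congr rfl fun x _ => ?_
    simp only [Complex.norm_real, Real.norm_eq_abs, sq_abs, inv_pow]
    ring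
  have h2 := sum_norm_sq_sub_le a (W ^ (n + 1) *ᵥ a)
  rw [sum_norm_sq_mulVec_of_unitary (pow_mem hW _)] at h2
  rw [h1, inv_mul_eq_div]
  gcongr
  linarith

/-- A left eigenvector `φ` of `W` with eigenvalue `1` has the same overlap with the average of the
powers of `W` at `|s⟩` as with `|s⟩`. -/
theorem le_average_pow {W : Matrix S S ℂ} (n : ℕ) (s : S)
    (φ : S → ℂ) (h : φ ᵥ* W = φ) :
    ‖φ s‖ ^ 2 ≤ (∑ x, ‖φ x‖ ^ 2) *
      ∑ x, ‖(((n + 1 : ℝ)⁻¹ : ℝ) • ∑ k ∈ Finset.range (n + 1), W ^ k *ᵥ ket s) x‖ ^ 2 := by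
  have hk : ∀ k : ℕ, φ ⬝ᵥ (W ^ k *ᵥ ket s) = φ s := fun k => by
    have : φ ᵥ* W ^ k = φ := by
      induction k with
      | zero => simp
      | succ k ih => rw [pow_succ, ← Matrix.vecMul_vecMul, ih, h]
    rw [Matrix.dotProduct_mulVec, this]
    simp [ket]
  refine le_trans (le_of_eq ?_) (norm_dotProduct_sq_le _ _)
  rw [dotProduct_smul, dotProduct_sum, Finset.sum_congr rfl fun k _ => hk k]
  rw [Finset.sum_const, Finset.card_range, nsmul_eq_mul, Complex.real_smul]
  push_cast
  rw [inv_mul_cancel_left₀ (by norm_cast)]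

end Average

/-! ### Distances in rooted trees -/

theorem AtDist.unique {X : Type} {rel : X → X → Prop} {r : X} (hr : ∀ x, ¬ rel x r)
    (hu : ∀ x x' y, rel x y → rel x' y → x = x') {n m : ℕ} {x : X} (hn : AtDist rel r n x)
    (hm : AtDist rel r m x) : n = m := by
  induction hn generalizing m with
  | zero =>
    cases hm with
    | zero => rfl
    | succ _ h => exact absurd h (hr _)
  | succ h1 h2 ih =>
    cases hm with
    | zero => exact absurd h2 (hr _)
    | succ h3 h4 =>
      obtain rfl := hu _ _ _ h2 h4
      rw [ih h3]

theorem atDist_distFrom {X : Type} {rel : X → X → Prop} {r x : X} (h : ∃ n, AtDist rel r n x) :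
    AtDist rel r (distFrom rel r x) x :=
  Nat.sInf_mem (s := {n | AtDist rel r n x}) h

namespace ComputationTree

variable {V : Type} (T : ComputationTree V)

/-! ### Parents, indices and levels in a computation tree -/

theorem not_isChild_root (u : V) : ¬ T.IsChild u T.root := fun ⟨i, h⟩ => T.child_ne_root u i h

theorem isChild_unique (u u' v : V) (h : T.IsChild u v) (h' : T.IsChild u' v) : u = u' := by
  obtain ⟨i, rfl⟩ := h
  obtain ⟨i', h⟩ := h'
  exact (congrArg Sigma.fst (@T.child_injective ⟨u', i'⟩ ⟨u, i⟩ h)).symm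

theorem exists_isChild {v : V} (hv : v ≠ T.root) : ∃ u, T.IsChild u v := by
  obtain ⟨n, h⟩ := T.reach v
  cases h with
  | zero => exact absurd rfl hv
  | succ _ h => exact ⟨_, h⟩

open Classical in
/-- The parent of a vertex; the root is its own parent. -/
def parent (v : V) : V := if h : ∃ u, T.IsChild u v then h.choose else v

theorem parent_eq {u v : V} (h : T.IsChild u v) : T.parent v = u := by
  have h' : ∃ u, T.IsChild u v := ⟨u, h⟩
  rw [parent, dif_pos h']
  exact T.isChild_unique _ _ _ h'.choose_spec h

theorem isChild_parent {v : V} (hv : v ≠ T.root) : T.IsChild (T.parent v) v := by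
  obtain ⟨u, hu⟩ := T.exists_isChild hv
  rwa [T.parent_eq hu]

open Classical in
/-- The index of a vertex among the children of its parent; `0` for the root. -/
def index (v : V) : ℕ :=
  if h : ∃ p : (Σ u : V, Fin (T.deg u)), T.child p.1 p.2 = v then h.choose.2 else 0

theorem index_child (u : V) (i : Fin (T.deg u)) : T.index (T.child u i) = i := by
  have h : ∃ p : (Σ u : V, Fin (T.deg u)), T.child p.1 p.2 = T.child u i := ⟨⟨u, i⟩, rfl⟩
  have h' : h.choose = ⟨u, i⟩ := T.child_injective h.choose_spec
  rw [index, dif_pos h, h']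

/-- The distance from the root. -/
def level (v : V) : ℕ := distFrom T.IsChild T.root v

theorem atDist_level (v : V) : AtDist T.IsChild T.root (T.level v) v := atDist_distFrom (T.reach v)

theorem level_root : T.level T.root = 0 :=
  AtDist.unique T.not_isChild_root T.isChild_unique (T.atDist_level _) .zero

theorem level_of_isChild {u v : V} (h : T.IsChild u v) : T.level v = T.level u + 1 :=
  AtDist.unique T.not_isChild_root T.isChild_unique (T.atDist_level v) (.succ (T.atDist_level u) h)

theorem level_eq_level_parent {v : V} (hv : v ≠ T.root) : T.level v = T.level (T.parent v) + 1 :=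
  T.level_of_isChild (T.isChild_parent hv)

theorem level_le_depth [Fintype V] (v : V) : T.level v ≤ T.depth :=
  Finset.le_sup (f := fun v => distFrom T.IsChild T.root v) (Finset.mem_univ v)

theorem time_le_maxTime [Fintype V] (v : V) : T.time v ≤ T.maxTime :=
  Finset.le_sup (Finset.mem_univ v)

theorem deg_le_maxDeg [Fintype V] (v : V) : T.deg v ≤ T.maxDeg :=
  Finset.le_sup (Finset.mem_univ v)

theorem pathLen_pos (v : V) : 0 < T.pathLen v := by
  have : 2 ^ 1 ≤ 2 ^ (Nat.log 2 (T.time v) + 1) := Nat.pow_le_pow_right (by norm_num) (by omega)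
  rw [pathLen]; omega

theorem time_le_pathLen (v : V) : T.time v ≤ T.pathLen v := by
  have := Nat.lt_pow_succ_log_self (b := 2) (by norm_num) (T.time v)
  rw [pathLen]; omega

theorem pathLen_odd (v : V) : T.pathLen v % 2 = 1 := by
  have := Nat.one_le_two_pow (n := Nat.log 2 (T.time v))
  rw [pathLen, pow_succ]; omega

theorem pathLen_lt {v : V} (hv : v ≠ T.root) : T.pathLen v < 2 * T.time v := by
  have h := Nat.pow_log_le_self 2 (T.time_pos v hv).ne'
  have := Nat.one_le_two_pow (n := Nat.log 2 (T.time v))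
  rw [pathLen, pow_succ]; omega

/-- The end of the path of `v` is the first end `j` of a block with `t_v ≤ j`. -/
theorem eq_pathLen_iff {v : V} (hv : v ≠ T.root) {j : ℕ} (hj : 0 < j) (hle : j ≤ T.pathLen v) :
    j = T.pathLen v ↔ T.time v ≤ j ∧ ∃ a, j + 1 = 2 ^ a := by
  constructor
  · rintro rfl
    have := Nat.one_le_two_pow (n := Nat.log 2 (T.time v) + 1)
    exact ⟨T.time_le_pathLen v, Nat.log 2 (T.time v) + 1, by rw [pathLen]; omega⟩
  · rintro ⟨h, a, ha⟩
    have h1 : 2 ^ Nat.log 2 (T.time v) ≤ T.time v := Nat.pow_log_le_self 2 (T.time_pos v hv).ne'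
    have h2 : Nat.log 2 (T.time v) < a :=
      (Nat.pow_lt_pow_iff_right (a := 2) (by norm_num)).1 (by omega)
    have h3 : 2 ^ (Nat.log 2 (T.time v) + 1) ≤ 2 ^ a := Nat.pow_le_pow_right (by norm_num) h2
    rw [pathLen] at hle ⊢; omega

/-! ### The expanded tree -/

open Classical in
/-- The vertex of the expanded tree at which the path of `v` ends. -/
def endOf (v : V) : T.Expanded :=
  if h : v = T.root then none
  else some ⟨⟨v, h⟩, ⟨T.pathLen v - 1, Nat.sub_lt (T.pathLen_pos v) one_pos⟩⟩

theorem endOf_root : T.endOf T.root = none := by simp [endOf]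

theorem endOf_of_ne {v : V} (h : v ≠ T.root) :
    T.endOf v = some ⟨⟨v, h⟩, ⟨T.pathLen v - 1, Nat.sub_lt (T.pathLen_pos v) one_pos⟩⟩ := by
  simp [endOf, h]

/-- The parent in the expanded tree; the root is its own parent. -/
def expParent : T.Expanded → T.Expanded
  | none => none
  | some ⟨v, j⟩ => if j.val = 0 then T.endOf (T.parent v) else some ⟨v, ⟨j - 1, by omega⟩⟩

theorem expChild_iff (x y : T.Expanded) : T.ExpChild x y ↔ y ≠ none ∧ x = T.expParent y := by
  rcases y with _ | ⟨⟨v, hv⟩, j⟩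
  · cases x <;> simp [ExpChild]
  have hpar : ∀ u, T.IsChild u v ↔ T.parent v = u :=
    fun u => ⟨T.parent_eq, fun h => h ▸ T.isChild_parent hv⟩
  rcases x with _ | ⟨⟨u, hu⟩, i⟩
  · simp only [ExpChild, hpar, expParent]
    by_cases hj : j.val = 0
    · by_cases hr : T.parent v = T.root
      · simp [hj, hr, endOf_root]
      · simp [hj, hr, endOf_of_ne]
    · simp [hj]
  · simp only [ExpChild, hpar, expParent]
    by_cases hj : j.val = 0
    · by_cases hr : T.parent v = T.root
      · have : T.root ≠ u := fun h => hu h.symm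
        simp [hj, hr, endOf_root, this]
      · have hpos := T.pathLen_pos u
        by_cases hpu : T.parent v = u
        · subst hpu
          simp [hj, endOf_of_ne, hu, Fin.ext_iff]
          omega
        · have : u ≠ T.parent v := Ne.symm hpu
          simp [hj, hr, hpu, endOf_of_ne, this]
    · by_cases huv : u = v
      · subst huv
        simp [hj, Fin.ext_iff]
        omega
      · simp [hj, huv]

theorem not_expChild_none (x : T.Expanded) : ¬ T.ExpChild x none := by simp [expChild_iff]

theorem expChild_unique (x x' y : T.Expanded) (h : T.ExpChild x y) (h' : T.ExpChild x' y) :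
    x = x' := by
  rw [expChild_iff] at h h'
  rw [h.2, h'.2]

theorem exists_atDist_some {v : V} (hv : v ≠ T.root)
    (h : ∃ n, AtDist T.ExpChild none n (T.endOf (T.parent v))) (j : Fin (T.pathLen v)) :
    ∃ n, AtDist T.ExpChild none n (some ⟨⟨v, hv⟩, j⟩) := by
  obtain ⟨j, hj⟩ := j
  induction j with
  | zero =>
    obtain ⟨n, hn⟩ := h
    exact ⟨n + 1, hn.succ (by simp [expChild_iff, expParent])⟩
  | succ j ih =>
    obtain ⟨n, hn⟩ := ih (by omega)
    exact ⟨n + 1, hn.succ (by simp [expChild_iff, expParent])⟩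

theorem exists_atDist_endOf (v : V) : ∃ n, AtDist T.ExpChild none n (T.endOf v) := by
  obtain ⟨n, h⟩ := T.reach v
  induction h with
  | zero => exact ⟨0, by rw [endOf_root]; exact .zero⟩
  | @succ n u v _ huv ih =>
    have hv : v ≠ T.root := by rintro rfl; exact T.not_isChild_root u huv
    rw [endOf_of_ne T hv]
    exact T.exists_atDist_some hv (by rwa [T.parent_eq huv]) _

theorem exists_atDist (x : T.Expanded) : ∃ n, AtDist T.ExpChild none n x := by
  rcases x with _ | ⟨⟨v, hv⟩, j⟩
  · exact ⟨0, .zero⟩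
  · exact T.exists_atDist_some hv (T.exists_atDist_endOf _) j

/-- The parity of the distance from the root in the expanded tree. As all paths have odd length,
it is determined by the level of the vertex and the position on its path. -/
def parity : T.Expanded → ℕ
  | none => 0
  | some ⟨v, j⟩ => (T.level v + j) % 2

theorem parity_lt (x : T.Expanded) : T.parity x < 2 := by
  rcases x with _ | ⟨v, j⟩ <;> simp only [parity] <;> omega

theorem parity_endOf (v : V) : T.parity (T.endOf v) = T.level v % 2 := by
  by_cases h : v = T.root
  · subst h; simp [endOf_root, parity, level_root]
  · have := T.pathLen_odd v
    rw [endOf_of_ne T h, parity]; dsimp only; omega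

theorem parity_expParent {y : T.Expanded} (hy : y ≠ none) :
    T.parity y = (T.parity (T.expParent y) + 1) % 2 := by
  rcases y with _ | ⟨⟨v, hv⟩, j⟩
  · exact absurd rfl hy
  · have := T.level_eq_level_parent hv
    simp only [expParent]
    split_ifs with hj
    · rw [parity_endOf, parity]; dsimp only; omega
    · simp only [parity]; omega

theorem distFrom_mod_two (x : T.Expanded) : distFrom T.ExpChild none x % 2 = T.parity x := by
  have h := atDist_distFrom (T.exists_atDist x)
  generalize distFrom T.ExpChild none x = n at h
  induction h with
  | zero => rfl
  | @succ n x y _ hxy ih =>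
    rw [expChild_iff] at hxy
    rw [parity_expParent T hxy.1, ← hxy.2, ← ih]
    omega

/-- The centre of the star of a vertex of parity `p` that contains `y`. (There is none if `y` is
the root and `p = 1`.) -/
def owner (p : ℕ) (y : T.Expanded) : T.Expanded := if T.parity y = p then y else T.expParent y

theorem parity_owner {p : ℕ} (hp : p < 2) {y : T.Expanded} (hy : y = none → p = 0) :
    T.parity (T.owner p y) = p := by
  rw [owner]
  split_ifs with h
  · exact h
  · have hy' : y ≠ none := fun h' => h (by rw [hy h', h']; rfl)
    have h1 := T.parity_expParent hy'
    have h2 := T.parity_lt (T.expParent y)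
    omega

theorem mem_star_iff {p : ℕ} (hp : p < 2) (x y : T.Expanded) :
    (T.parity x = p ∧ (y = x ∨ T.ExpChild x y)) ↔ (y = none → p = 0) ∧ x = T.owner p y := by
  constructor
  · rintro ⟨rfl, rfl | h⟩
    · exact ⟨by rintro rfl; rfl, by simp [owner]⟩
    · rw [expChild_iff] at h
      refine ⟨fun h' => absurd h' h.1, ?_⟩
      have h1 := T.parity_expParent h.1
      rw [owner, if_neg, h.2]
      rw [h.2]; omega
  · rintro ⟨hy, rfl⟩
    refine ⟨T.parity_owner hp hy, ?_⟩
    rw [owner]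
    split_ifs with h
    · exact .inl rfl
    · exact .inr ((T.expChild_iff _ _).2 ⟨fun h' => h (by rw [hy h', h']; rfl), rfl⟩)

theorem weight_pos {D : ℕ} (hD : 1 ≤ D) (τ : ℕ) (x : T.Expanded) : 0 < T.weight D τ x := by
  rcases x with _ | ⟨v, j⟩
  · have : (0 : ℝ) < D := by exact_mod_cast hD
    simp only [weight]; positivity
  · simp only [weight]; positivity

theorem starVec_eq_zero {D τ p : ℕ} (hp : p < 2) {x y : T.Expanded} (hx : T.parity x = p)
    (h : ¬ ((y = none → p = 0) ∧ x = T.owner p y)) : T.starVec D τ x y = 0 := by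
  rw [← T.mem_star_iff hp] at h
  rw [starVec, if_neg fun h' => h ⟨hx, h'⟩]

variable [Fintype V] [DecidableEq V]

/-- In the column of `y`, the diffusion operator is the reflection about one star state. -/
theorem diffusion_apply (D τ : ℕ) {p : ℕ} (hp : p < 2) (z y : T.Expanded) :
    open Classical in
    T.diffusion D τ p z y = (if z = y then 1 else 0) -
      if (y = none → p = 0) ∧ ¬ T.ExpMarked (T.owner p y) then
        2 * ((T.starVec D τ (T.owner p y) z * T.starVec D τ (T.owner p y) y /
          ∑ y', T.starVec D τ (T.owner p y) y' ^ 2 : ℝ) : ℂ) else 0 := by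
  classical
  rw [diffusion, Matrix.sub_apply, Matrix.one_apply, Matrix.smul_apply, Matrix.sum_apply,
    Finset.sum_eq_single (T.owner p y)]
  · congr 1
    rw [distFrom_mod_two]
    by_cases hy : y = none → p = 0
    · by_cases hm : T.ExpMarked (T.owner p y)
      · simp [hm]
      · rw [if_pos ⟨hm, T.parity_owner hp hy⟩, if_pos ⟨hy, hm⟩]
        simp [starProj]
    · rw [if_neg (fun h : (y = none → p = 0) ∧ _ => hy h.1)]
      split_ifs with h
      · have := T.starVec_eq_zero (D := D) (τ := τ) hp (y := y) h.2 fun h' => hy h'.1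
        simp [starProj, this]
      · simp
  · intro x _ hx
    rw [distFrom_mod_two]
    split_ifs with h
    · have := T.starVec_eq_zero (D := D) (τ := τ) hp (y := y) h.2 fun h' => hx h'.2
      simp [starProj, this]
    · rfl
  · simp

theorem diffusion_symm (D τ p : ℕ) (z y : T.Expanded) :
    T.diffusion D τ p z y = T.diffusion D τ p y z := by
  classical
  simp only [diffusion, Matrix.sub_apply, Matrix.one_apply, Matrix.smul_apply, Matrix.sum_apply]
  congr 1
  · simp [eq_comm]
  · congr 1
    refine Finset.sum_congr rfl fun x _ => ?_
    split_ifs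
    · simp only [starProj, Matrix.of_apply, mul_comm]
    · rfl

theorem diffusion_mulVec_apply (D τ : ℕ) {p : ℕ} (hp : p < 2) (φ : T.Expanded → ℝ)
    (y : T.Expanded) :
    open Classical in
    (T.diffusion D τ p *ᵥ fun z => (φ z : ℂ)) y = ((φ y -
      if (y = none → p = 0) ∧ ¬ T.ExpMarked (T.owner p y) then
        2 * (T.starVec D τ (T.owner p y) y / ∑ y', T.starVec D τ (T.owner p y) y' ^ 2) *
          ∑ z, T.starVec D τ (T.owner p y) z * φ z else 0 : ℝ) : ℂ) := by
  classical
  simp only [Matrix.mulVec, dotProduct, T.diffusion_symm D τ p y, T.diffusion_apply D τ hp]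
  split_ifs with h
  · simp only [sub_mul, Finset.sum_sub_distrib]
    push_cast
    congr 1
    · simp
    · rw [Finset.mul_sum]
      refine Finset.sum_congr rfl fun z _ => ?_
      ring
  · simp

end ComputationTree

/-! ### Sums over blocks of lengths `1, 2, 4, …` -/

theorem sum_range_blocks (g : ℕ → ℝ) (a : ℕ) :
    ∑ i ∈ Finset.range (2 ^ a - 1), g (Nat.log 2 (i + 1)) = ∑ b ∈ Finset.range a, 2 ^ b * g b := by
  induction a with
  | zero => simp
  | succ a ih =>
    have h1 := Nat.one_le_two_pow (n := a)
    have h2 : 2 ^ (a + 1) - 1 = (2 ^ a - 1) + 2 ^ a := by rw [pow_succ]; omega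
    rw [h2, Finset.sum_range_add, ih, Finset.sum_range_succ]
    congr 1
    rw [Finset.sum_congr rfl (g := fun _ => g a), Finset.sum_const, Finset.card_range, nsmul_eq_mul]
    · push_cast; rfl
    · intro i hi
      rw [Finset.mem_range] at hi
      congr 1
      refine Nat.log_eq_of_pow_le_of_lt_pow ?_ ?_
      · omega
      · rw [pow_succ]; omega

namespace ComputationTree

variable {V : Type} (T : ComputationTree V)

theorem starVec_eq {D τ p : ℕ} (hp : p < 2) {y : T.Expanded} (hy : y = none → p = 0) :
    T.starVec D τ (T.owner p y) y = √(T.weight D τ y) := by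
  rw [starVec, if_pos ((T.mem_star_iff hp _ y).2 ⟨hy, rfl⟩).2]

theorem starVec_mul_sqrt {D τ : ℕ} (x y : T.Expanded) :
    T.starVec D τ x y * √(T.weight D τ y) = T.starVec D τ x y ^ 2 := by
  rw [starVec]; split_ifs <;> ring

theorem expMarked_endOf {v : V} (h : T.marked v = true) : T.ExpMarked (T.endOf v) := by
  by_cases hv : v = T.root
  · subst hv; simpa [endOf_root, ExpMarked] using h
  · rw [endOf_of_ne T hv]
    exact ⟨Nat.sub_add_cancel (T.pathLen_pos v), h⟩

variable [Fintype V] [DecidableEq V]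

theorem sum_starVec_sq_pos {D τ : ℕ} (hD : 1 ≤ D) (x : T.Expanded) :
    0 < ∑ y, T.starVec D τ x y ^ 2 := by
  refine lt_of_lt_of_le ?_ (Finset.single_le_sum (fun y _ => sq_nonneg _) (Finset.mem_univ x))
  rw [starVec, if_pos (.inl rfl), Real.sq_sqrt (T.weight_pos hD τ x).le]
  exact T.weight_pos hD τ x

/-! ### The walk without marked vertices -/

theorem diffusion_mulVec_sqrt_weight {D τ p : ℕ} (hD : 1 ≤ D) (hp : p < 2)
    (hm : ∀ x, ¬ T.ExpMarked x) (y : T.Expanded) :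
    open Classical in
    (T.diffusion D τ p *ᵥ fun z => ((√(T.weight D τ z) : ℝ) : ℂ)) y =
      ((if y = none → p = 0 then -√(T.weight D τ y) else √(T.weight D τ y) : ℝ) : ℂ) := by
  classical
  rw [T.diffusion_mulVec_apply D τ hp]
  congr 1
  have hn := (T.sum_starVec_sq_pos (τ := τ) hD (T.owner p y)).ne'
  simp only [starVec_mul_sqrt, hm, not_false_eq_true, and_true]
  split_ifs with h
  · rw [T.starVec_eq hp h]
    field_simp
    ring
  · ring

/-- Without marked vertices, both diffusions negate the vector of the square roots of the weights,
but for the root, which the diffusion of the odd distances fixes. -/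
theorem sub_walkStep_mulVec_sqrt_weight {D τ : ℕ} (hD : 1 ≤ D) (hm : ∀ x, ¬ T.ExpMarked x) :
    (fun y => ((√(T.weight D τ y) : ℝ) : ℂ)) -
      T.walkStep D τ *ᵥ (fun y => ((√(T.weight D τ y) : ℝ) : ℂ)) =
      ((2 * √(T.weight D τ none) : ℝ) : ℂ) • ket none := by
  have h0 : T.diffusion D τ 0 *ᵥ (fun y => ((√(T.weight D τ y) : ℝ) : ℂ)) =
      -fun y => ((√(T.weight D τ y) : ℝ) : ℂ) := by
    ext y; rw [T.diffusion_mulVec_sqrt_weight hD two_pos hm]; simp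
  ext y
  rw [walkStep, ← Matrix.mulVec_mulVec, h0, Matrix.mulVec_neg]
  simp only [Pi.sub_apply, Pi.neg_apply, Pi.smul_apply]
  rw [T.diffusion_mulVec_sqrt_weight hD one_lt_two hm]
  by_cases hy : y = none
  · subst hy; simp [ket_apply]; ring
  · simp [ket_apply, hy]

theorem sum_weight_le {D τ : ℕ} (hD : 1 ≤ D) :
    ∑ y, T.weight D τ y ≤ 1 + 4 / 3 * T.sqTime := by
  have hD' : (1 : ℝ) ≤ D := by exact_mod_cast hD
  have hr : T.weight D τ none ≤ 1 := by
    simp only [weight]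
    rw [div_le_one (by positivity)]
    nlinarith [(Nat.cast_nonneg (Nat.log 2 τ) : (0 : ℝ) ≤ _)]
  have hv : ∀ v : {v // v ≠ T.root},
      ∑ j, T.weight D τ (some ⟨v, j⟩) ≤ 4 / 3 * (T.time v : ℝ) ^ 2 := by
    intro v
    have h4 : ∀ b : ℕ, (2 : ℝ) ^ b * 2 ^ b = 4 ^ b := fun b => by rw [← mul_pow]; norm_num
    have h1 : ∑ j, T.weight D τ (some ⟨v, j⟩) =
        ∑ i ∈ Finset.range (T.pathLen v), (2 : ℝ) ^ Nat.log 2 (i + 1) :=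
      Fin.sum_univ_eq_sum_range (fun i => (2 : ℝ) ^ Nat.log 2 (i + 1)) _
    have h2 := Nat.pow_log_le_self 2 (T.time_pos v v.2).ne'
    have h3 : ((2 : ℝ) ^ Nat.log 2 (T.time v)) ^ 2 ≤ (T.time v : ℝ) ^ 2 := by
      gcongr; exact_mod_cast h2
    rw [h1, pathLen, sum_range_blocks (fun b => (2 : ℝ) ^ b)]
    simp only [h4]
    rw [geom_sum_eq (by norm_num), pow_succ, ← h4]
    linarith
  have hsq : ∑ v : {v // v ≠ T.root}, (T.time v : ℝ) ^ 2 ≤ T.sqTime := by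
    rw [sqTime]
    push_cast
    rw [← Finset.sum_subtype (Finset.univ.filter fun v => v ≠ T.root) (by simp)
      fun v => (T.time v : ℝ) ^ 2]
    exact Finset.sum_le_sum_of_subset_of_nonneg (Finset.subset_univ _) fun _ _ _ => sq_nonneg _
  rw [Fintype.sum_option, Fintype.sum_sigma]
  have := Finset.sum_le_sum fun v (_ : v ∈ Finset.univ) => hv v
  rw [← Finset.mul_sum] at this
  linarith

/-! ### The walk with a marked vertex -/

/-- The sum of the inverse weights from the root (exclusive) to a vertex of the expanded tree, with
`⌊log₂ τ⌋ + 1` as a bound for the contribution of each complete path. -/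
def resistance (τ : ℕ) : T.Expanded → ℝ
  | none => 0
  | some ⟨v, j⟩ => ((T.level v : ℝ) - 1) * (Nat.log 2 τ + 1) +
      ∑ i ∈ Finset.range (j + 1), ((2 : ℝ) ^ Nat.log 2 (i + 1))⁻¹

omit [DecidableEq V] in
theorem resistance_endOf_le {τ : ℕ} (hτ : T.maxTime ≤ τ) (v : V) :
    T.resistance τ (T.endOf v) ≤ T.level v * (Nat.log 2 τ + 1) := by
  by_cases hv : v = T.root
  · subst hv; simp [endOf_root, resistance, level_root]
  · rw [endOf_of_ne T hv, resistance]
    dsimp only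
    rw [Nat.sub_add_cancel (show 1 ≤ T.pathLen v from T.pathLen_pos v), pathLen,
      sum_range_blocks fun b => ((2 : ℝ) ^ b)⁻¹]
    have h1 : ((Nat.log 2 (T.time v) : ℕ) : ℝ) ≤ (Nat.log 2 τ : ℕ) := by
      exact_mod_cast Nat.log_mono_right ((T.time_le_maxTime v).trans hτ)
    have h2 : ∀ b : ℕ, (2 : ℝ) ^ b * (2 ^ b)⁻¹ = 1 := fun b => by field_simp
    simp only [h2, Finset.sum_const, Finset.card_range, nsmul_eq_mul]
    push_cast
    linarith

omit [DecidableEq V] in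
theorem resistance_expParent_le {D τ : ℕ} (hτ : T.maxTime ≤ τ) {y : T.Expanded} (hy : y ≠ none) :
    T.resistance τ (T.expParent y) + (T.weight D τ y)⁻¹ ≤ T.resistance τ y := by
  rcases y with _ | ⟨⟨v, hv⟩, j⟩
  · exact absurd rfl hy
  simp only [expParent]
  split_ifs with hj
  · have h1 := T.resistance_endOf_le hτ (T.parent v)
    simp only [resistance, weight, hj, T.level_eq_level_parent hv]
    simp
    exact h1
  · obtain ⟨k, hk⟩ := Nat.exists_eq_succ_of_ne_zero hj
    simp only [resistance, weight, hk, Nat.succ_eq_add_one, Nat.add_sub_cancel]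
    rw [Finset.sum_range_succ _ (k + 1)]
    linarith

/-- The alternating unit flow from the root to a vertex `x` is orthogonal to all stars but that
of `x`. -/
theorem exists_flow {D τ : ℕ} (hD : 1 ≤ D) (hτ : T.maxTime ≤ τ) {n : ℕ} {x : T.Expanded}
    (hx : AtDist T.ExpChild none n x) :
    open Classical in
    ∃ φ : T.Expanded → ℝ, φ none = (√(T.weight D τ none))⁻¹ ∧
      (∀ z, φ z ≠ 0 → ∃ m ≤ n, AtDist T.ExpChild none m z) ∧
      (∃ ε : ℝ, ε ^ 2 = 1 ∧ ∀ z, ∑ y, T.starVec D τ z y * φ y = if z = x then ε else 0) ∧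
      ∑ y, φ y ^ 2 ≤ (T.weight D τ none)⁻¹ + T.resistance τ x := by
  classical
  induction hx with
  | zero =>
    refine ⟨fun y => if y = none then (√(T.weight D τ none))⁻¹ else 0, by simp, ?_,
      ⟨1, by simp, ?_⟩, ?_⟩
    · intro z hz
      have : z = none := by by_contra h; simp [h] at hz
      exact ⟨0, le_rfl, this ▸ .zero⟩
    · intro z
      have := (Real.sqrt_pos.2 (T.weight_pos hD τ none)).ne'
      rw [Finset.sum_eq_single none (by simp +contextual) (by simp)]
      simp only [starVec, T.not_expChild_none, or_false, if_true]
      by_cases hz : z = none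
      · simp [hz, this]
      · simp [hz, Ne.symm hz]
    · rw [Finset.sum_eq_single none (by simp +contextual) (by simp)]
      simp [resistance, Real.sq_sqrt (T.weight_pos hD τ none).le]
  | @succ n x y hx hxy ih =>
    obtain ⟨φ, h0, hsupp, ⟨ε, hε, hstar⟩, hnorm⟩ := ih
    have hxy' := (T.expChild_iff x y).1 hxy
    have hw := T.weight_pos hD τ y
    have hs := (Real.sqrt_pos.2 hw).ne'
    have hφy : φ y = 0 := by
      by_contra h
      obtain ⟨m, hm, h'⟩ := hsupp y h
      have := AtDist.unique T.not_expChild_none T.expChild_unique h' (hx.succ hxy)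
      omega
    refine ⟨fun z => φ z - if z = y then ε * (√(T.weight D τ y))⁻¹ else 0, ?_, ?_,
      ⟨-ε, by rwa [neg_sq], ?_⟩, ?_⟩
    · simp [h0, Ne.symm hxy'.1]
    · intro z hz
      by_cases hzy : z = y
      · exact ⟨n + 1, le_rfl, hzy ▸ hx.succ hxy⟩
      · obtain ⟨m, hm, h'⟩ := hsupp z (by simpa [hzy] using hz)
        exact ⟨m, by omega, h'⟩
    · intro z
      simp only [mul_sub, Finset.sum_sub_distrib, hstar]
      rw [Finset.sum_eq_single y (by simp +contextual) (by simp), if_pos rfl, starVec,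
        T.expChild_iff, ← hxy'.2]
      have hne : x ≠ y := by
        rintro rfl
        have := AtDist.unique T.not_expChild_none T.expChild_unique hx (hx.succ hxy)
        omega
      by_cases hzx : z = x
      · subst hzx
        simp only [hxy'.1, ne_eq, not_false_eq_true, and_self, or_true, if_true, hne, if_false]
        field_simp
        ring
      · by_cases hzy : z = y
        · subst hzy
          simp only [true_or, if_true, hzx, if_false]
          field_simp
          ring
        · simp [hzx, hzy, Ne.symm hzy]
    · have : ∀ z, (φ z - if z = y then ε * (√(T.weight D τ y))⁻¹ else 0) ^ 2 =
          φ z ^ 2 + if z = y then (T.weight D τ y)⁻¹ else 0 := by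
        intro z
        by_cases hzy : z = y
        · subst hzy
          simp [hφy, mul_pow, hε, Real.sq_sqrt hw.le]
        · simp [hzy]
      simp only [this, Finset.sum_add_distrib]
      have h := T.resistance_expParent_le (D := D) hτ hxy'.1
      rw [← hxy'.2] at h
      rw [Finset.sum_ite_eq', if_pos (Finset.mem_univ _)]
      linarith

/-- The flow to a marked vertex is an invariant vector of the walk, and the root carries at least
half of its squared norm. -/
theorem exists_invariant {D τ : ℕ} (hD : 1 ≤ D) (hτ : T.maxTime ≤ τ) (hdepth : T.depth ≤ D)
    {v : V} (hv : T.marked v = true) :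
    ∃ φ : T.Expanded → ℝ, T.walkStep D τ *ᵥ (fun y => (φ y : ℂ)) = (fun y => (φ y : ℂ)) ∧
      0 < φ none ∧ ∑ y, φ y ^ 2 ≤ 2 * φ none ^ 2 := by
  classical
  obtain ⟨n, hn⟩ := T.exists_atDist_endOf v
  obtain ⟨φ, h0, -, ⟨ε, -, hstar⟩, hnorm⟩ := T.exists_flow hD hτ hn
  have hdiff : ∀ p < 2, T.diffusion D τ p *ᵥ (fun y => (φ y : ℂ)) = (fun y => (φ y : ℂ)) := by
    intro p hp
    ext y
    rw [T.diffusion_mulVec_apply D τ hp]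
    congr 1
    split_ifs with h
    · have : T.owner p y ≠ T.endOf v := fun h' => h.2 (h' ▸ T.expMarked_endOf hv)
      simp [hstar, this]
    · simp
  have hw := T.weight_pos hD τ none
  refine ⟨φ, ?_, ?_, hnorm.trans ?_⟩
  · rw [walkStep, ← Matrix.mulVec_mulVec, hdiff 0 two_pos, hdiff 1 one_lt_two]
  · rw [h0]; exact inv_pos.2 (Real.sqrt_pos.2 hw)
  · have h1 : T.resistance τ (T.endOf v) ≤ (T.weight D τ none)⁻¹ := by
      refine (T.resistance_endOf_le hτ v).trans ?_
      simp only [weight, one_div, inv_inv]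
      gcongr
      exact (T.level_le_depth v).trans hdepth
    rw [h0, inv_pow, Real.sq_sqrt hw.le]
    linarith

end ComputationTree

/-! ### Reflections controlled by the remaining registers -/

/-- The gate that applies the unitary `M x` to the register `C` of a product basis if the rest is in
the basis state `x`. -/
def blockGate {Idx : Type} {Q : Idx → Type} {S C R : Type} [Fintype S] [DecidableEq S] [Fintype C]
    [DecidableEq C] (r : S ≃ C × R) (M : R → Matrix.unitaryGroup C ℂ) : Gate Q S :=
  open Classical in
  .free ⟨Matrix.of fun s t => if (r s).2 = (r t).2 then (M (r s).2).1 (r s).1 (r t).1 else 0, by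
    rw [Matrix.mem_unitaryGroup_iff']
    ext s t
    have h := congrFun (congrFun (Matrix.mem_unitaryGroup_iff'.1 (M (r s).2).2) (r s).1) (r t).1
    rw [Matrix.mul_apply] at h ⊢
    by_cases hst : (r s).2 = (r t).2
    · have h1 : (1 : Matrix S S ℂ) s t = (1 : Matrix C C ℂ) (r s).1 (r t).1 := by
        rw [Matrix.one_apply, Matrix.one_apply]
        congr 1
        rw [← r.apply_eq_iff_eq, Prod.ext_iff, eq_iff_iff]
        exact and_iff_left hst
      rw [h1, ← h, ← Finset.sum_subset
        (Finset.subset_univ (Finset.univ.image fun c => r.symm (c, (r s).2))), Finset.sum_image]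
      · simp [Matrix.star_apply, hst]
      · intro a _ b _ h; simpa using h
      · intro s' _ hs'
        have : (r s').2 ≠ (r s).2 := fun h => hs' (by
          simp only [Finset.mem_image, Finset.mem_univ, true_and]
          exact ⟨(r s').1, by simp [← h]⟩)
        simp [Matrix.star_apply, this]
    · rw [Matrix.one_apply_ne (by rintro rfl; exact hst rfl)]
      refine Finset.sum_eq_zero fun s' _ => ?_
      by_cases h' : (r s').2 = (r s).2
      · simp [h', hst]
      · simp [Matrix.star_apply, h']⟩

theorem blockGate_ket {Idx : Type} {Q : Idx → Type} {S C R : Type} [Fintype S] [DecidableEq S]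
    [Fintype C] [DecidableEq C] (F : ∀ o, Matrix (Q o) (Q o) ℂ) (r : S ≃ C × R)
    (M : R → Matrix.unitaryGroup C ℂ) (s : S) :
    (blockGate r M : Gate Q S).eval F *ᵥ ket s =
      ∑ c, (M (r s).2).1 c (r s).1 • ket (r.symm (c, (r s).2)) := by
  classical
  rw [mulVec_ket]
  ext t
  simp only [blockGate, Gate.eval, Matrix.of_apply, Finset.sum_apply, Pi.smul_apply, ket_apply,
    smul_eq_mul]
  by_cases h : (r t).2 = (r s).2
  · rw [Finset.sum_eq_single (r t).1]
    · simp [← h]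
    · intro c _ hc
      rw [if_neg, mul_zero]
      rintro rfl
      simp at hc
    · simp
  · rw [if_neg h, Finset.sum_eq_zero]
    intro c _
    rw [if_neg, mul_zero]
    rintro rfl
    simp at h

/-! ### The registers of the walk circuit -/

/-- The values of the register that distinguishes the vertices of the star of `x`: `x` itself, the
next vertex on the same path, where the transition is still running (`next`) or has finished
(`wait`), and the first vertex on the path of a child. -/
inductive Slot (Δ : ℕ)
  | self
  | next
  | wait
  | child (i : Fin (Δ + 1))
  deriving DecidableEq, Fintype

/-- The data about an ancestor that are put aside: the description of its parent, its index, its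
transition time, and the length of its path. -/
abbrev Entry (B : Type) (Δ τ : ℕ) : Type := B × Fin (Δ + 1) × Fin (τ + 1) × Fin (2 * τ + 1)

/-- The register for the data of up to `D` ancestors. -/
abbrev Stack (B : Type) (Δ D τ : ℕ) : Type := {l : List (Entry B Δ τ) // l.length ≤ D}

instance (B : Type) [Fintype B] (Δ D τ : ℕ) : Fintype (Stack B Δ D τ) :=
  @Fintype.ofFinite _ (List.finite_length_le _ D).to_subtype

/-- The basis of the walk circuit. The registers are: the ancestors, the position on the path, the
slot in the star, the answers of the oracles (degree, mark, finished), and the arguments of the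
oracle for the transitions (parent, index, work register, time). -/
abbrev WalkReg (B : Type) (Δ D τ : ℕ) : Type :=
  Stack B Δ D τ × Fin (2 * τ + 1) × Slot Δ × Fin (Δ + 1) × Bool × Bool ×
    B × Fin (Δ + 1) × B × Fin (τ + 1)

instance (B : Type) (Δ D τ : ℕ) : DecidableEq (WalkReg B Δ D τ) := Classical.decEq _

instance (B : Type) [Fintype B] (Δ τ : ℕ) (o : OracleName) : Fintype (OracleReg B Δ τ o) :=
  match o with
  | .degree => inferInstanceAs (Fintype (B × Fin (Δ + 1)))
  | .mark => inferInstanceAs (Fintype (B × Bool))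
  | .step => inferInstanceAs (Fintype (B × Fin (Δ + 1) × B × Fin (τ + 1)))
  | .finished => inferInstanceAs (Fintype (B × Fin (Δ + 1) × B × Fin (τ + 1) × Bool))

instance (B : Type) [DecidableEq B] (Δ τ : ℕ) (o : OracleName) :
    DecidableEq (OracleReg B Δ τ o) :=
  match o with
  | .degree => inferInstanceAs (DecidableEq (B × Fin (Δ + 1)))
  | .mark => inferInstanceAs (DecidableEq (B × Bool))
  | .step => inferInstanceAs (DecidableEq (B × Fin (Δ + 1) × B × Fin (τ + 1)))
  | .finished => inferInstanceAs (DecidableEq (B × Fin (Δ + 1) × B × Fin (τ + 1) × Bool))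

instance (B : Type) [Nonempty B] (Δ τ : ℕ) (o : OracleName) : Nonempty (OracleReg B Δ τ o) :=
  match o with
  | .degree => inferInstanceAs (Nonempty (B × Fin (Δ + 1)))
  | .mark => inferInstanceAs (Nonempty (B × Bool))
  | .step => inferInstanceAs (Nonempty (B × Fin (Δ + 1) × B × Fin (τ + 1)))
  | .finished => inferInstanceAs (Nonempty (B × Fin (Δ + 1) × B × Fin (τ + 1) × Bool))

section Machine

variable {B : Type} {Δ D τ : ℕ}

/-- The register of the oracle `A`. -/
def stepSplit : WalkReg B Δ D τ ≃ (B × Fin (Δ + 1) × B × Fin (τ + 1)) ×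
    (Stack B Δ D τ × Fin (2 * τ + 1) × Slot Δ × Fin (Δ + 1) × Bool × Bool) where
  toFun := fun (l, j, c, g, m, f, a, i, b, t) => ((a, i, b, t), (l, j, c, g, m, f))
  invFun := fun ((a, i, b, t), (l, j, c, g, m, f)) => (l, j, c, g, m, f, a, i, b, t)
  left_inv _ := rfl
  right_inv _ := rfl

/-- The register of the oracle `O_f`. -/
def finishedSplit : WalkReg B Δ D τ ≃ (B × Fin (Δ + 1) × B × Fin (τ + 1) × Bool) ×
    (Stack B Δ D τ × Fin (2 * τ + 1) × Slot Δ × Fin (Δ + 1) × Bool) where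
  toFun := fun (l, j, c, g, m, f, a, i, b, t) => ((a, i, b, t, f), (l, j, c, g, m))
  invFun := fun ((a, i, b, t, f), (l, j, c, g, m)) => (l, j, c, g, m, f, a, i, b, t)
  left_inv _ := rfl
  right_inv _ := rfl

/-- The register of the oracle `C`. -/
def degreeSplit : WalkReg B Δ D τ ≃ (B × Fin (Δ + 1)) × (Stack B Δ D τ × Fin (2 * τ + 1) ×
    Slot Δ × Bool × Bool × B × Fin (Δ + 1) × Fin (τ + 1)) where
  toFun := fun (l, j, c, g, m, f, a, i, b, t) => ((b, g), (l, j, c, m, f, a, i, t))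
  invFun := fun ((b, g), (l, j, c, m, f, a, i, t)) => (l, j, c, g, m, f, a, i, b, t)
  left_inv _ := rfl
  right_inv _ := rfl

/-- The register of the oracle `M`. -/
def markSplit : WalkReg B Δ D τ ≃ (B × Bool) × (Stack B Δ D τ × Fin (2 * τ + 1) ×
    Slot Δ × Fin (Δ + 1) × Bool × B × Fin (Δ + 1) × Fin (τ + 1)) where
  toFun := fun (l, j, c, g, m, f, a, i, b, t) => ((b, m), (l, j, c, g, f, a, i, t))
  invFun := fun ((b, m), (l, j, c, g, f, a, i, t)) => (l, j, c, g, m, f, a, i, b, t)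
  left_inv _ := rfl
  right_inv _ := rfl

/-- The register for the slot in the star. -/
def slotSplit : WalkReg B Δ D τ ≃ Slot Δ × (Stack B Δ D τ × Fin (2 * τ + 1) ×
    Fin (Δ + 1) × Bool × Bool × B × Fin (Δ + 1) × B × Fin (τ + 1)) where
  toFun := fun (l, j, c, g, m, f, a, i, b, t) => (c, (l, j, g, m, f, a, i, b, t))
  invFun := fun (c, (l, j, g, m, f, a, i, b, t)) => (l, j, c, g, m, f, a, i, b, t)
  left_inv _ := rfl
  right_inv _ := rfl

/-- If the distance from the root has not the parity `p`, then go back one position, and put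
into the slot whether the transition was running in the step that leads forward again. -/
def stepBack (p : ℕ) : WalkReg B Δ D τ → WalkReg B Δ D τ :=
  fun (l, j, c, g, m, f, a, i, b, t) =>
    if l.1 ≠ [] ∧ (l.1.length + j.val + 1) % 2 ≠ p then
      (l, ⟨j.val - 1, by omega⟩, if t.val = j.val then .next else .wait, g, m, f, a, i, b, t)
    else (l, j, c, g, m, f, a, i, b, t)

theorem stepBack_injOn (p : ℕ) :
    Set.InjOn (stepBack p : WalkReg B Δ D τ → WalkReg B Δ D τ)
      {s | s.2.2.1 = .self ∧ 0 < s.2.1.val} := by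
  rintro ⟨l, j, c, g, m, f, a, i, b, t⟩ ⟨rfl, hj⟩ ⟨l', j', c', g', m', f', a', i', b', t'⟩
    ⟨rfl, hj'⟩ h
  simp only [stepBack] at h hj hj'
  split_ifs at h <;> simp_all [Fin.ext_iff]
  omega

/-- At the beginning of a path, return to the parent, with the index of the path as the slot. -/
def popAncestor [DecidableEq B] (b₀ : B) : WalkReg B Δ D τ → WalkReg B Δ D τ
  | (⟨e :: l, h⟩, j, .next, g, m, f, a, i, b, t) =>
    if j.val = 0 ∧ t.val = 0 ∧ b = b₀ then
      (⟨l, (Nat.le_succ _).trans h⟩, e.2.2.2, .child i, g, m, f, e.1, e.2.1, a, e.2.2.1)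
    else (⟨e :: l, h⟩, j, .next, g, m, f, a, i, b, t)
  | s => s

theorem popAncestor_injOn [DecidableEq B] (b₀ : B) :
    Set.InjOn (popAncestor b₀ : WalkReg B Δ D τ → WalkReg B Δ D τ)
      {s | ∀ i, s.2.2.1 ≠ .child i} := by
  rintro ⟨⟨_ | ⟨⟨e₁, e₂, e₃, e₄⟩, l⟩, hl⟩, j, c | _ | _ | _, g, m, f, a, i, b, t⟩ hs
    ⟨⟨_ | ⟨⟨e₁', e₂', e₃', e₄'⟩, l'⟩, hl'⟩, j', c' | _ | _ | _, g', m', f', a', i', b', t'⟩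
    hs' h <;>
  first
    | exact absurd rfl (hs _)
    | exact absurd rfl (hs' _)
    | (simp only [popAncestor] at h
       (try split_ifs at h) <;> grind)

end Machine

/-! ### The walk circuit -/

section WalkCircuit

/-- Whether a vertex, given by its ancestors, its position, and the answer of `O_f`, is the root or
the end of the path of a vertex of the computation tree. -/
def IsEnd {B : Type} {Δ D τ : ℕ} (l : Stack B Δ D τ) (j : Fin (2 * τ + 1)) (f : Bool) : Prop :=
  l.1 = [] ∨ (f = true ∧ ∃ a, j.val + 1 = 2 ^ a)

open Classical in
/-- The unnormalised star state of a vertex as a state of the slot register. It is set to `0` for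
marked vertices and for those whose distance from the root has not the parity `p`. -/
def amplitude {B : Type} {Δ D τ : ℕ} (p : ℕ) (l : Stack B Δ D τ) (j : Fin (2 * τ + 1))
    (g : Fin (Δ + 1)) (m f : Bool) :
    Slot Δ → ℝ
  | .self => if (l.1.length + j.val + 1) % 2 = p ∧ m = false then
      (if l.1 = [] then √(1 / ((D : ℝ) * ((Nat.log 2 τ : ℝ) + 1))) else √(2 ^ Nat.log 2 j.val))
    else 0
  | .next => if (l.1.length + j.val + 1) % 2 = p ∧ m = false ∧ ¬ IsEnd l j f ∧ f = false then
      √(2 ^ Nat.log 2 (j.val + 1)) else 0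
  | .wait => if (l.1.length + j.val + 1) % 2 = p ∧ m = false ∧ ¬ IsEnd l j f ∧ f = true then
      √(2 ^ Nat.log 2 (j.val + 1)) else 0
  | .child i => if (l.1.length + j.val + 1) % 2 = p ∧ m = false ∧ IsEnd l j f ∧ i.val < g.val then
      1 else 0

variable {B : Type} [Fintype B] {Δ D τ : ℕ}

/-- A permutation that extends `stepBack` from the states with the slot `self`. -/
def backPerm (p : ℕ) : Equiv.Perm (WalkReg B Δ D τ) :=
  (exists_perm_of_injOn _ _ (stepBack_injOn p)).choose

theorem backPerm_apply (p : ℕ) (s : WalkReg B Δ D τ) (h : s.2.2.1 = .self) (h' : 0 < s.2.1.val) :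
    backPerm p s = stepBack p s :=
  (exists_perm_of_injOn _ _ (stepBack_injOn p)).choose_spec s ⟨h, h'⟩

variable [DecidableEq B]

/-- A permutation that extends `popAncestor` from the states whose slot is not that of a child. -/
def popPerm (b₀ : B) : Equiv.Perm (WalkReg B Δ D τ) :=
  (exists_perm_of_injOn _ _ (popAncestor_injOn b₀)).choose

theorem popPerm_apply (b₀ : B) (s : WalkReg B Δ D τ) (h : ∀ i, s.2.2.1 ≠ .child i) :
    popPerm b₀ s = popAncestor b₀ s :=
  (exists_perm_of_injOn _ _ (popAncestor_injOn b₀)).choose_spec s h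

/-- The circuit that maps the states that encode the vertices of the star of a vertex `x` whose
distance from the root has the parity `p` to the state that encodes `x`, with different slots. -/
def gatherCircuit (b₀ : B) (p : ℕ) : Circuit (OracleReg B Δ τ) (WalkReg B Δ D τ) :=
  [permGate (backPerm p),
    ctrlQuery .step true stepSplit fun x => x.2.2.1 = .next,
    permGate (popPerm b₀)]

/-- The circuit that asks whether the transition has finished, and, at the end of a path, for the
degree and the mark. -/
def flagCircuit : Circuit (OracleReg B Δ τ) (WalkReg B Δ D τ) :=
  [ctrlQuery .finished false finishedSplit fun x => x.1.1 ≠ [],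
    ctrlQuery .degree false degreeSplit fun x => IsEnd x.1 x.2.1 x.2.2.2.2.1,
    ctrlQuery .mark false markSplit fun x => IsEnd x.1 x.2.1 x.2.2.2.2.1]

/-- The gate that reflects the slot register about the star state. -/
def starGate (p : ℕ) : Gate (OracleReg B Δ τ) (WalkReg B Δ D τ) :=
  blockGate slotSplit fun (l, j, g, m, f, _) =>
    ⟨householder (amplitude p l j g m f), householder_mem_unitary _⟩

/-- The circuit for the diffusion about the stars of parity `p`. -/
def diffusionCircuit (b₀ : B) (p : ℕ) : Circuit (OracleReg B Δ τ) (WalkReg B Δ D τ) :=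
  gatherCircuit b₀ p ++ (flagCircuit ++ (starGate p ::
    (Circuit.inv flagCircuit ++ Circuit.inv (gatherCircuit b₀ p))))

/-- The circuit for the step of the quantum walk. -/
def walkCircuit (b₀ : B) : Circuit (OracleReg B Δ τ) (WalkReg B Δ D τ) :=
  diffusionCircuit b₀ 0 ++ diffusionCircuit b₀ 1

theorem walkCircuit_queryCount (b₀ : B) :
    (walkCircuit b₀ : Circuit (OracleReg B Δ τ) (WalkReg B Δ D τ)).queryCount = 16 := by
  have h1 : ∀ p, (gatherCircuit b₀ p :
      Circuit (OracleReg B Δ τ) (WalkReg B Δ D τ)).queryCount = 1 := fun _ => rfl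
  have h2 : (flagCircuit : Circuit (OracleReg B Δ τ) (WalkReg B Δ D τ)).queryCount = 3 := rfl
  have h3 : ∀ p c, Circuit.queryCount ((starGate p :
      Gate (OracleReg B Δ τ) (WalkReg B Δ D τ)) :: c) = Circuit.queryCount c := fun _ _ => by
    simp [Circuit.queryCount, starGate, blockGate, Gate.isQuery]
  simp only [walkCircuit, diffusionCircuit, Circuit.queryCount_append, Circuit.queryCount_inv, h1,
    h2, h3]

end WalkCircuit

/-! ### The states that encode the vertices -/

theorem stepKet_eq_spread {B : Type} [Fintype B] [DecidableEq B] {Δ τ : ℕ} (u : B) (i : ℕ)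
    (φ : B → ℂ) (t : ℕ) : (stepKet u i φ t : B × Fin (Δ + 1) × B × Fin (τ + 1) → ℂ) =
      spread (fun b => (u, Fin.ofNat (Δ + 1) i, b, Fin.ofNat (τ + 1) t)) φ := by
  ext ⟨a, j, b, s⟩
  rw [spread_apply, Finset.sum_eq_single b]
  · simp only [stepKet, ket_apply, Prod.mk.injEq, true_and]
    split_ifs <;> simp_all
  · intro b' _ h
    simp [Ne.symm h]
  · simp

theorem finishedKet_eq_spread {B : Type} [Fintype B] [DecidableEq B] {Δ τ : ℕ} (u : B) (i : ℕ)
    (φ : B → ℂ) (t : ℕ) (f : Bool) :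
    (finishedKet u i φ t f : B × Fin (Δ + 1) × B × Fin (τ + 1) × Bool → ℂ) =
      spread (fun b => (u, Fin.ofNat (Δ + 1) i, b, Fin.ofNat (τ + 1) t, f)) φ := by
  ext ⟨a, j, b, s, e⟩
  rw [spread_apply, Finset.sum_eq_single b]
  · simp only [finishedKet, ket_apply, Prod.mk.injEq, true_and]
    split_ifs <;> simp_all
  · intro b' _ h
    simp [Ne.symm h]
  · simp

namespace ComputationTree

variable {V : Type} (T : ComputationTree V)

/-- The vertex of the computation tree on whose path a vertex of the expanded tree lies. -/
def vert : T.Expanded → V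
  | none => T.root
  | some ⟨v, _⟩ => v

/-- The position of a vertex on its path. The root counts as a path of length `1`. -/
def pos : T.Expanded → ℕ
  | none => 1
  | some ⟨_, j⟩ => j + 1

theorem vert_some (v : {v // v ≠ T.root}) (j : Fin (T.pathLen v)) :
    T.vert (some ⟨v, j⟩) = v := rfl

theorem pos_some (v : {v // v ≠ T.root}) (j : Fin (T.pathLen v)) :
    T.pos (some ⟨v, j⟩) = j + 1 := rfl

theorem parent_root : T.parent T.root = T.root := by
  rw [parent, dif_neg]
  rintro ⟨u, hu⟩
  exact T.not_isChild_root u hu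

theorem index_root : T.index T.root = 0 := by
  rw [index, dif_neg]
  rintro ⟨p, hp⟩
  exact T.child_ne_root _ _ hp

theorem pathLen_root : T.pathLen T.root = 1 := by simp [pathLen, T.time_root]

theorem vert_endOf (v : V) : T.vert (T.endOf v) = v := by
  by_cases h : v = T.root
  · subst h; simp [endOf_root, vert]
  · simp [endOf_of_ne T h, vert]

theorem pos_endOf (v : V) : T.pos (T.endOf v) = T.pathLen v := by
  by_cases h : v = T.root
  · subst h; simp [endOf_root, pos, pathLen_root]
  · simp [endOf_of_ne T h, pos, Nat.sub_add_cancel (show 1 ≤ T.pathLen v from T.pathLen_pos v)]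

theorem pos_pos (x : T.Expanded) : 0 < T.pos x := by
  rcases x with _ | ⟨v, j⟩ <;> simp [pos]

theorem pos_le_pathLen (x : T.Expanded) : T.pos x ≤ T.pathLen (T.vert x) := by
  rcases x with _ | ⟨v, j⟩
  · simp [pos, vert, pathLen_root]
  · exact j.2

theorem ext_vert_pos {x y : T.Expanded} (hv : T.vert x = T.vert y) (hp : T.pos x = T.pos y) :
    x = y := by
  rcases x with _ | ⟨⟨v, h⟩, j⟩ <;> rcases y with _ | ⟨⟨w, h'⟩, i⟩
  · rfl
  · exact absurd hv.symm h'
  · exact absurd hv h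
  · simp only [vert, pos] at hv hp
    subst hv
    have : j = i := Fin.ext (by omega)
    rw [this]

theorem eq_endOf_iff (x : T.Expanded) :
    x = T.endOf (T.vert x) ↔ T.pos x = T.pathLen (T.vert x) := by
  constructor
  · intro h
    conv_lhs => rw [h]
    rw [pos_endOf]
  · intro h
    exact T.ext_vert_pos (T.vert_endOf _).symm (by rw [pos_endOf, h])

theorem expMarked_iff (x : T.Expanded) :
    T.ExpMarked x ↔ x = T.endOf (T.vert x) ∧ T.marked (T.vert x) = true := by
  rw [eq_endOf_iff]
  rcases x with _ | ⟨v, j⟩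
  · simp [ExpMarked, pos, vert, pathLen_root]
  · simp [ExpMarked, pos, vert]

theorem parity_eq (x : T.Expanded) : T.parity x = (T.level (T.vert x) + T.pos x + 1) % 2 := by
  rcases x with _ | ⟨v, j⟩
  · simp [parity, vert, pos, level_root]
  · simp only [parity, vert, pos]; omega

theorem level_eq_zero_iff (v : V) : T.level v = 0 ↔ v = T.root := by
  constructor
  · intro h
    by_contra hv
    rw [T.level_eq_level_parent hv] at h
    omega
  · rintro rfl; exact T.level_root

open Classical in
/-- The slot of `y` in the star of `T.owner p y`. -/
def slot (Δ p : ℕ) (y : T.Expanded) : Slot Δ :=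
  if T.parity y = p then .self
  else match y with
    | none => .self
    | some ⟨v, j⟩ =>
      if j.val = 0 then .child (Fin.ofNat (Δ + 1) (T.index v))
      else if j.val + 1 ≤ T.time v then .next else .wait

variable {B : Type} [DecidableEq B] {Δ D τ : ℕ} (desc : V ↪ B) (work : V → ℕ → B → ℂ)

/-- The data that are put aside about a vertex when the walk enters the path of a child. -/
def entry (Δ τ : ℕ) {B : Type} (desc : V ↪ B) (v : V) : Entry B Δ τ :=
  (desc (T.parent v), Fin.ofNat _ (T.index v), Fin.ofNat _ (T.time v), Fin.ofNat _ (T.pathLen v))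

/-- The entries of the `n` closest strict ancestors of a vertex. -/
def ancestors (Δ τ : ℕ) {B : Type} (desc : V ↪ B) : ℕ → V → List (Entry B Δ τ)
  | 0, _ => []
  | n + 1, v => T.entry Δ τ desc (T.parent v) :: ancestors Δ τ desc n (T.parent v)

theorem length_ancestors {B : Type} (desc : V ↪ B) (n : ℕ) (v : V) :
    (T.ancestors Δ τ desc n v).length = n := by
  induction n generalizing v with
  | zero => rfl
  | succ n ih => simp [ancestors, ih]

/-- The state of the work register after `k` or, if this is less, `t_v` steps of the transition
to `v`. -/
def workState [DecidableEq V] (v : V) (k : ℕ) : B → ℂ :=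
  if v = T.root then ket (desc T.root) else work v (min k (T.time v))

variable [Fintype V] {T}

/-- The stack of all strict ancestors of a vertex. -/
def stackOf (Δ τ : ℕ) {B : Type} (hdepth : T.depth ≤ D) (desc : V ↪ B) (v : V) : Stack B Δ D τ :=
  ⟨T.ancestors Δ τ desc (T.level v) v, by
    rw [length_ancestors]; exact (T.level_le_depth v).trans hdepth⟩

theorem stackOf_length {B : Type} (hdepth : T.depth ≤ D) (desc : V ↪ B) (v : V) :
    (stackOf Δ τ hdepth desc v).1.length = T.level v := T.length_ancestors _ _ _

theorem stackOf_eq_nil_iff {B : Type} (hdepth : T.depth ≤ D) (desc : V ↪ B) (v : V) :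
    (stackOf Δ τ hdepth desc v).1 = [] ↔ v = T.root := by
  rw [← List.length_eq_zero_iff, stackOf_length, level_eq_zero_iff]

theorem stackOf_eq_cons {B : Type} (hdepth : T.depth ≤ D) (desc : V ↪ B) {v : V}
    (hv : v ≠ T.root) : (stackOf Δ τ hdepth desc v).1 =
      T.entry Δ τ desc (T.parent v) :: (stackOf Δ τ hdepth desc (T.parent v)).1 := by
  simp only [stackOf, T.level_eq_level_parent hv, ancestors]

variable [DecidableEq V] [Fintype B]

/-- The state that encodes position `k` on the path of `v`, with given contents of the slot
register and of the registers for the answers of the oracles. -/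
def place (hdepth : T.depth ≤ D) (v : V) (k : ℕ) (c : Slot Δ) (g : Fin (Δ + 1)) (m f : Bool) :
    WalkReg B Δ D τ → ℂ :=
  spread (fun b => (stackOf Δ τ hdepth desc v, Fin.ofNat _ k, c, g, m, f, desc (T.parent v),
    Fin.ofNat _ (T.index v), b, Fin.ofNat _ (min k (T.time v)))) (T.workState desc work v k)

variable {desc work} {b₀ : B} {O : Oracles B Δ τ}

omit [Fintype V] in
theorem workState_of_le (hacc : O.Access b₀ T desc work) {v : V} {k : ℕ} (h : T.time v ≤ k) :
    T.workState desc work v k = ket (desc v) := by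
  rw [workState]
  split_ifs with hv
  · rw [hv]
  · rw [min_eq_right h, hacc.work_time v hv]

omit [Fintype V] [DecidableEq V] in
theorem star_work_dotProduct (hacc : O.Access b₀ T desc work) {v : V} (hv : v ≠ T.root) {t : ℕ}
    (ht : t ≤ T.time v) : star (work v t) ⬝ᵥ work v t = 1 := by
  obtain ⟨u, i, rfl⟩ := T.exists_isChild hv
  have hinj : ∀ t, Function.Injective fun b : B =>
      (desc u, Fin.ofNat (Δ + 1) i.val, b, Fin.ofNat (τ + 1) t) := fun t b b' h => by
    simpa using h
  induction t with
  | zero => rw [hacc.work_zero _ hv, ← ofReal_sum_norm_sq, sum_norm_sq_ket]; simp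
  | succ t ih =>
    have h := hacc.step_apply u i t ht
    rw [stepKet_eq_spread, stepKet_eq_spread] at h
    rw [← spread_inner _ (hinj (t + 1)), ← h, ← ofReal_sum_norm_sq,
      sum_norm_sq_mulVec_of_unitary hacc.unitary_step, ofReal_sum_norm_sq, spread_inner _ (hinj t)]
    exact ih (by omega)

omit [Fintype V] in
theorem star_workState_dotProduct (hacc : O.Access b₀ T desc work) (v : V) (k : ℕ) :
    star (T.workState desc work v k) ⬝ᵥ T.workState desc work v k = 1 := by
  rw [workState]
  split_ifs with hv
  · rw [← ofReal_sum_norm_sq, sum_norm_sq_ket]; simp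
  · exact star_work_dotProduct hacc hv (min_le_right _ _)

theorem ofNat_inj {n a b : ℕ} (ha : a ≤ n) (hb : b ≤ n)
    (h : Fin.ofNat (n + 1) a = Fin.ofNat (n + 1) b) : a = b := by
  have := congrArg Fin.val h
  simpa [Fin.val_ofNat, Nat.mod_eq_of_lt (Nat.lt_succ_of_le ha),
    Nat.mod_eq_of_lt (Nat.lt_succ_of_le hb)] using this

theorem index_le (hΔ : T.maxDeg ≤ Δ) (v : V) : T.index v ≤ Δ := by
  by_cases hv : v = T.root
  · rw [hv, index_root]; omega
  · obtain ⟨u, i, rfl⟩ := T.exists_isChild hv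
    rw [index_child]
    exact i.2.le.trans ((T.deg_le_maxDeg u).trans hΔ)

omit [DecidableEq V] in
theorem pos_le (hτ : T.maxTime ≤ τ) (h1 : 1 ≤ τ) (x : T.Expanded) : T.pos x ≤ 2 * τ := by
  rcases x with _ | ⟨⟨v, hv⟩, j⟩
  · simp only [pos]; omega
  · have := T.pathLen_lt hv
    have := T.time_le_maxTime v
    have := j.2
    simp only [pos] at *
    omega

omit [Fintype V] [DecidableEq V] in
theorem eq_of_parent_eq_of_index_eq {v w : V} (hv : v ≠ T.root) (hw : w ≠ T.root)
    (hp : T.parent v = T.parent w) (hi : T.index v = T.index w) : v = w := by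
  obtain ⟨u, i, rfl⟩ := T.exists_isChild hv
  obtain ⟨u', i', rfl⟩ := T.exists_isChild hw
  rw [T.parent_eq ⟨i, rfl⟩, T.parent_eq ⟨i', rfl⟩] at hp
  subst hp
  rw [index_child, index_child] at hi
  rw [Fin.ext hi]

/-- The state that encodes a vertex of the expanded tree. -/
def encState (Δ τ : ℕ) (desc : V ↪ B) (work : V → ℕ → B → ℂ) (hdepth : T.depth ≤ D)
    (x : T.Expanded) : WalkReg B Δ D τ → ℂ :=
  place desc work hdepth (T.vert x) (T.pos x) .self 0 false false

/-- The states that encode the vertices of the expanded tree are orthonormal. -/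
theorem star_encState_dotProduct (hdepth : T.depth ≤ D) (hτ : T.maxTime ≤ τ) (h1 : 1 ≤ τ)
    (hΔ : T.maxDeg ≤ Δ) (hacc : O.Access b₀ T desc work) (x y : T.Expanded) :
    star (encState Δ τ desc work hdepth x) ⬝ᵥ encState Δ τ desc work hdepth y =
      if x = y then 1 else 0 := by
  split_ifs with hxy
  · subst hxy
    rw [encState, place, spread_inner, star_workState_dotProduct hacc]
    intro b b' h
    simpa using h
  · refine spread_orthogonal _ _ _ _ fun b b' h => hxy ?_
    simp only [Prod.mk.injEq, true_and] at h
    obtain ⟨hs, hj, ha, hi, -⟩ := h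
    have hpos := ofNat_inj (pos_le hτ h1 x) (pos_le hτ h1 y) hj
    have hnil := stackOf_eq_nil_iff (Δ := Δ) (τ := τ) hdepth desc (T.vert x)
    rw [hs, stackOf_eq_nil_iff] at hnil
    refine T.ext_vert_pos ?_ hpos
    by_cases hx : T.vert x = T.root
    · rw [hx, hnil.2 hx]
    · exact eq_of_parent_eq_of_index_eq hx (fun h => hx (hnil.1 h)) (desc.injective ha)
        (ofNat_inj (index_le hΔ _) (index_le hΔ _) hi)

end ComputationTree

namespace ComputationTree

variable {V : Type} {T : ComputationTree V} {B : Type} [DecidableEq B] {Δ D τ : ℕ} {desc : V ↪ B}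
  {work : V → ℕ → B → ℂ} [Fintype V] [DecidableEq V] [Fintype B] {b₀ : B} {O : Oracles B Δ τ}

/-! ### Gathering the states of a star -/

theorem val_ofNat_of_le {n a : ℕ} (h : a ≤ n) : (Fin.ofNat (n + 1) a).val = a :=
  Nat.mod_eq_of_lt (Nat.lt_succ_of_le h)

omit [Fintype B] in
theorem popAncestor_of_ne (b₀ : B) (s : WalkReg B Δ D τ)
    (h : s.2.2.1 ≠ .next ∨ s.2.2.2.2.2.2.2.2.2.val ≠ 0) : popAncestor b₀ s = s := by
  obtain ⟨⟨_ | ⟨e, l⟩, hl⟩, j, c | _ | _ | _, g, m, f, a, i, b, t⟩ := s <;>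
    simp_all [popAncestor]

omit [Fintype V] [DecidableEq V] in
theorem step_query (hacc : O.Access b₀ T desc work) {v : V} (hv : v ≠ T.root) {k : ℕ}
    (hk : k + 1 ≤ T.time v) (l : Stack B Δ D τ) (j : Fin (2 * τ + 1)) (g : Fin (Δ + 1))
    (m f : Bool) :
    (ctrlQuery .step true stepSplit (fun x => x.2.2.1 = .next) :
      Gate (OracleReg B Δ τ) (WalkReg B Δ D τ)).eval O.family *ᵥ
        spread (fun b => (l, j, .next, g, m, f, desc (T.parent v), Fin.ofNat _ (T.index v), b,
          Fin.ofNat _ (k + 1))) (work v (k + 1)) =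
      spread (fun b => (l, j, .next, g, m, f, desc (T.parent v), Fin.ofNat _ (T.index v), b,
          Fin.ofNat _ k)) (work v k) := by
  obtain ⟨u, i, rfl⟩ := T.exists_isChild hv
  refine ctrlQuery_spread O.family .step true stepSplit _
    (fun b => (desc (T.parent (T.child u i)), Fin.ofNat _ (T.index (T.child u i)), b,
      Fin.ofNat _ (k + 1)))
    (fun b => (desc (T.parent (T.child u i)), Fin.ofNat _ (T.index (T.child u i)), b,
      Fin.ofNat _ k)) (l, j, .next, g, m, f) rfl (fun _ => rfl) (fun _ => rfl) ?_
  have h := hacc.step_apply u i k hk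
  rw [stepKet_eq_spread, stepKet_eq_spread] at h
  rw [T.parent_eq ⟨i, rfl⟩, index_child]
  exact mulVec_conjTranspose_of_unitary hacc.unitary_step h

omit [Fintype V] [DecidableEq V] in
theorem owner_root (p : ℕ) : T.owner p none = none := by
  rw [owner]; split_ifs <;> rfl

omit [Fintype V] [DecidableEq V] in
theorem slot_root (p : ℕ) : T.slot Δ p none = .self := by
  rw [slot]; split_ifs <;> rfl

/-- The star states of the vertices of parity `p` are moved to the slot register. -/
theorem gatherCircuit_encState (hdepth : T.depth ≤ D) (hτ : T.maxTime ≤ τ) (h1 : 1 ≤ τ)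
    (hacc : O.Access b₀ T desc work) (p : ℕ) (y : T.Expanded) :
    Circuit.eval O.family (gatherCircuit b₀ p) *ᵥ encState Δ τ desc work hdepth y =
      place desc work hdepth (T.vert (T.owner p y)) (T.pos (T.owner p y)) (T.slot Δ p y) 0 false
        false := by
  have hpos := pos_le hτ h1 y
  have hval := val_ofNat_of_le hpos
  have hpar := T.parity_eq y
  simp only [gatherCircuit, Circuit.eval, one_mul, ← Matrix.mulVec_mulVec]
  rw [encState, place, permGate_spread]
  have hback := fun b => backPerm_apply p (stackOf Δ τ hdepth desc (T.vert y),
    Fin.ofNat (2 * τ + 1) (T.pos y), Slot.self, 0, false, false, desc (T.parent (T.vert y)),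
    Fin.ofNat (Δ + 1) (T.index (T.vert y)), b,
    Fin.ofNat (τ + 1) (min (T.pos y) (T.time (T.vert y)))) rfl (by rw [hval]; exact T.pos_pos y)
  simp only [hback, stepBack, hval, stackOf_length, ← hpar, ne_eq, stackOf_eq_nil_iff]
  by_cases hstay : ¬ (¬ T.vert y = T.root ∧ ¬ T.parity y = p)
  · -- The state of the root and those of the vertices of parity `p` are fixed.
    have howner : T.owner p y = y ∧ T.slot Δ p y = .self := by
      by_cases hp : T.parity y = p
      · simp [owner, slot, hp]
      · have hroot : T.vert y = T.root := by tauto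
        rcases y with _ | ⟨⟨v, hv⟩, j⟩
        · exact ⟨owner_root p, slot_root p⟩
        · exact absurd hroot hv
    simp only [if_neg hstay, howner]
    rw [ctrlQuery_spread_of_not _ _ _ _ _ (by intro b h; cases h), permGate_spread]
    have hpop := fun b => popPerm_apply b₀ (stackOf Δ τ hdepth desc (T.vert y),
      Fin.ofNat (2 * τ + 1) (T.pos y), Slot.self, 0, false, false, desc (T.parent (T.vert y)),
      Fin.ofNat (Δ + 1) (T.index (T.vert y)), b,
      Fin.ofNat (τ + 1) (min (T.pos y) (T.time (T.vert y)))) (by simp)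
    simp only [hpop]
    simp only [popAncestor_of_ne b₀ (_, _, Slot.self, _) (.inl (by simp))]
    rfl
  · rw [not_not] at hstay
    simp only [if_pos hstay]
    rcases y with _ | ⟨⟨v, hv⟩, ⟨j, hj⟩⟩
    · exact absurd rfl hstay.1
    simp only [vert_some, pos_some] at hpos ⊢
    have htime := (T.time_le_maxTime v).trans hτ
    have hmin : (Fin.ofNat (τ + 1) (min (j + 1) (T.time v))).val = min (j + 1) (T.time v) :=
      val_ofNat_of_le ((min_le_right _ _).trans htime)
    have hj' : (⟨j + 1 - 1, by omega⟩ : Fin (2 * τ + 1)) = Fin.ofNat (2 * τ + 1) j :=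
      Fin.ext (val_ofNat_of_le (by omega)).symm
    have hown : T.owner p (some ⟨⟨v, hv⟩, ⟨j, hj⟩⟩) =
      if j = 0 then T.endOf (T.parent v) else some ⟨⟨v, hv⟩, ⟨j - 1, by omega⟩⟩ := by
      rw [owner, if_neg hstay.2]; rfl
    have hslot : T.slot Δ p (some ⟨⟨v, hv⟩, ⟨j, hj⟩⟩) =
        if j = 0 then .child (Fin.ofNat (Δ + 1) (T.index v))
        else if j + 1 ≤ T.time v then .next else .wait := by
      rw [slot, if_neg hstay.2]
    rw [hown, hslot]
    simp only [hmin, hj']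
    by_cases hle : j + 1 ≤ T.time v
    · -- The transition is running: its last step is undone by the adjoint of `A`.
      simp only [min_eq_left hle, if_true, workState, if_neg hv, if_pos hle]
      rw [step_query hacc hv hle, permGate_spread]
      by_cases hj0 : j = 0
      · -- At its start the work register is blank, and the parent is restored.
        subst hj0
        simp only [if_true, vert_endOf, pos_endOf]
        rw [place, workState_of_le hacc (T.time_le_pathLen _), hacc.work_zero v hv, spread_ket,
          spread_ket, popPerm_apply _ _ (by simp)]
        have hcons := stackOf_eq_cons (Δ := Δ) (τ := τ) hdepth desc hv
        generalize stackOf Δ τ hdepth desc v = l at hcons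
        obtain ⟨l, hl⟩ := l
        simp only at hcons
        subst hcons
        simp only [popAncestor]
        rw [if_pos (by simp)]
        simp only [entry, min_eq_right (T.time_le_pathLen _)]
      · simp only [if_neg hj0]
        have hjv : (Fin.ofNat (τ + 1) j).val = j := val_ofNat_of_le (by omega)
        have hpop := fun b => popPerm_apply b₀ (stackOf Δ τ hdepth desc v,
          Fin.ofNat (2 * τ + 1) j, Slot.next, 0, false, false, desc (T.parent v),
          Fin.ofNat (Δ + 1) (T.index v), b, Fin.ofNat (τ + 1) j) (by simp)
        simp only [hpop]
        have hpop' := fun b => popAncestor_of_ne b₀ (stackOf Δ τ hdepth desc v,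
          Fin.ofNat (2 * τ + 1) j, Slot.next, 0, false, false, desc (T.parent v),
          Fin.ofNat (Δ + 1) (T.index v), b, Fin.ofNat (τ + 1) j) (.inr (by rwa [hjv]))
        simp only [hpop']
        simp only [place, vert_some, pos_some, Nat.sub_add_cancel (Nat.one_le_iff_ne_zero.2 hj0),
          min_eq_left (show j ≤ T.time v by omega), workState, if_neg hv]
    · -- The transition has finished: only the position changes.
      have hj0 : j ≠ 0 := fun h => hle (by have := T.time_pos v hv; omega)
      have hne : ¬ min (j + 1) (T.time v) = j + 1 := by omega
      simp only [hne, if_false, hle, hj0]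
      rw [ctrlQuery_spread_of_not _ _ _ _ _ (by intro b h; cases h), permGate_spread]
      have hpop := fun b => popPerm_apply b₀ (stackOf Δ τ hdepth desc v,
        Fin.ofNat (2 * τ + 1) j, Slot.wait, 0, false, false, desc (T.parent v),
        Fin.ofNat (Δ + 1) (T.index v), b, Fin.ofNat (τ + 1) (min (j + 1) (T.time v))) (by simp)
      simp only [hpop]
      simp only [popAncestor_of_ne b₀ (_, _, Slot.wait, _) (.inl (by simp))]
      simp only [place, vert_some, pos_some, Nat.sub_add_cancel (Nat.one_le_iff_ne_zero.2 hj0),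
        workState, if_neg hv,
        min_eq_right (show T.time v ≤ j + 1 by omega), min_eq_right (show T.time v ≤ j by omega)]

end ComputationTree

namespace ComputationTree

variable {V : Type} {T : ComputationTree V} {B : Type} {Δ D τ : ℕ} {desc : V ↪ B}
  {work : V → ℕ → B → ℂ}

/-! ### The answers of the oracles -/

open Classical in
/-- The answer of `O_f` at a vertex of the expanded tree; it is not asked at the root. -/
def flagFinished (x : T.Expanded) : Bool :=
  decide (T.vert x ≠ T.root ∧ T.time (T.vert x) ≤ T.pos x)

open Classical in
/-- The degree, which is asked for at the ends of the paths only. -/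
def flagDegree (Δ : ℕ) (x : T.Expanded) : Fin (Δ + 1) :=
  if x = T.endOf (T.vert x) then Fin.ofNat _ (T.deg (T.vert x)) else 0

open Classical in
/-- The mark, which is asked for at the ends of the paths only. -/
def flagMark (x : T.Expanded) : Bool :=
  decide (x = T.endOf (T.vert x) ∧ T.marked (T.vert x) = true)

theorem flagMark_eq_false_iff (x : T.Expanded) : flagMark x = false ↔ ¬ T.ExpMarked x := by
  rw [expMarked_iff, flagMark, decide_eq_false_iff_not]

variable [Fintype V]

theorem isEnd_iff (hdepth : T.depth ≤ D) (hτ : T.maxTime ≤ τ) (h1 : 1 ≤ τ) (x : T.Expanded) :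
    IsEnd (stackOf Δ τ hdepth desc (T.vert x)) (Fin.ofNat _ (T.pos x)) (flagFinished x) ↔
      x = T.endOf (T.vert x) := by
  classical
  rw [IsEnd, stackOf_eq_nil_iff, flagFinished, decide_eq_true_iff, eq_endOf_iff,
    val_ofNat_of_le (pos_le hτ h1 x)]
  by_cases hx : T.vert x = T.root
  · have hle := T.pos_le_pathLen x
    have hpos := T.pos_pos x
    rw [hx, pathLen_root] at hle
    rw [hx, pathLen_root]
    simp only [true_or, true_iff]
    omega
  · rw [T.eq_pathLen_iff hx (T.pos_pos x) (T.pos_le_pathLen x)]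
    simp [hx]

/-! ### The star states in the slot register -/

/-- The star state of a vertex of the expanded tree in the slot register. -/
def slotAmplitude (Δ τ p : ℕ) (desc : V ↪ B) (hdepth : T.depth ≤ D) (x : T.Expanded) :
    Slot Δ → ℝ :=
  amplitude p (stackOf Δ τ hdepth desc (T.vert x)) (Fin.ofNat _ (T.pos x)) (flagDegree Δ x)
    (flagMark x) (flagFinished x)

theorem slotAmplitude_eq (p : ℕ) (hdepth : T.depth ≤ D) (hτ : T.maxTime ≤ τ) (h1 : 1 ≤ τ)
    (x : T.Expanded) (c : Slot Δ) :
    open Classical in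
    slotAmplitude Δ τ p desc hdepth x c =
      if T.parity x = p ∧ ¬ T.ExpMarked x then
        match c with
        | .self => √(T.weight D τ x)
        | .next => if x ≠ T.endOf (T.vert x) ∧ T.pos x < T.time (T.vert x) then
            √(2 ^ Nat.log 2 (T.pos x + 1)) else 0
        | .wait => if x ≠ T.endOf (T.vert x) ∧ T.time (T.vert x) ≤ T.pos x then
            √(2 ^ Nat.log 2 (T.pos x + 1)) else 0
        | .child i => if x = T.endOf (T.vert x) ∧ i.val < (flagDegree Δ x).val then 1 else 0
      else 0 := by
  classical
  have hpos := pos_le hτ h1 x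
  have hroot : x ≠ T.endOf (T.vert x) → T.vert x ≠ T.root := fun h h' => h (by
    rw [h', endOf_root]
    rcases x with _ | ⟨⟨v, hv⟩, j⟩
    · rfl
    · exact absurd h' hv)
  rcases c with _ | _ | _ | i <;>
    simp only [slotAmplitude, amplitude, stackOf_length, val_ofNat_of_le hpos, ← T.parity_eq,
      flagMark_eq_false_iff, isEnd_iff hdepth hτ h1, stackOf_eq_nil_iff]
  · split_ifs with h h'
    · rcases x with _ | ⟨⟨v, hv⟩, j⟩
      · rfl
      · exact absurd h' hv
    · rcases x with _ | ⟨v, j⟩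
      · exact absurd rfl h'
      · rfl
    · rfl
  · by_cases h : x = T.endOf (T.vert x)
    · simp [← h]
    · by_cases h' : T.parity x = p ∧ ¬ T.ExpMarked x
      · simp [h, h', hroot h, flagFinished]
      · rw [if_neg h', if_neg fun h'' => h' ⟨h''.1, h''.2.1⟩]
  · by_cases h : x = T.endOf (T.vert x)
    · simp [← h]
    · by_cases h' : T.parity x = p ∧ ¬ T.ExpMarked x
      · simp [h, h', hroot h, flagFinished]
      · rw [if_neg h', if_neg fun h'' => h' ⟨h''.1, h''.2.1⟩]
  · by_cases h' : T.parity x = p ∧ ¬ T.ExpMarked x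
    · simp [h']
    · rw [if_neg h', if_neg fun h'' => h' ⟨h''.1, h''.2.1⟩]

theorem val_flagDegree_endOf (hΔ : T.maxDeg ≤ Δ) {x : T.Expanded} (hx : x = T.endOf (T.vert x)) :
    (flagDegree Δ x).val = T.deg (T.vert x) := by
  rw [flagDegree, if_pos hx, val_ofNat_of_le ((T.deg_le_maxDeg _).trans hΔ)]

/-- The amplitude of the slot of `z` in the star state is that of `z`. -/
theorem slotAmplitude_owner {p : ℕ} (hp : p < 2) (hdepth : T.depth ≤ D) (hτ : T.maxTime ≤ τ)
    (h1 : 1 ≤ τ) (hΔ : T.maxDeg ≤ Δ) {z : T.Expanded} (hz : z = none → p = 0)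
    (hm : ¬ T.ExpMarked (T.owner p z)) :
    slotAmplitude Δ τ p desc hdepth (T.owner p z) (T.slot Δ p z) =
      T.starVec D τ (T.owner p z) z := by
  classical
  rw [slotAmplitude_eq p hdepth hτ h1, if_pos ⟨T.parity_owner hp hz, hm⟩, T.starVec_eq hp hz]
  by_cases hzp : T.parity z = p
  · simp [slot, owner, hzp]
  rcases z with _ | ⟨⟨v, hv⟩, j⟩
  · exact absurd (hz rfl).symm hzp
  simp only [owner, slot, if_neg hzp, expParent]
  by_cases hj : j.val = 0
  · have hdeg := val_flagDegree_endOf hΔ (x := T.endOf (T.parent v)) (by rw [vert_endOf])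
    obtain ⟨u, i, rfl⟩ := T.exists_isChild hv
    rw [vert_endOf, T.parent_eq ⟨i, rfl⟩] at hdeg
    have hi : i.val ≤ Δ := i.2.le.trans ((T.deg_le_maxDeg u).trans hΔ)
    simp only [hj, if_true, vert_endOf, T.parent_eq ⟨i, rfl⟩, index_child, hdeg,
      val_ofNat_of_le hi, i.2, weight]
    simp
  · have hne : (some ⟨⟨v, hv⟩, ⟨j.val - 1, by omega⟩⟩ : T.Expanded) ≠ T.endOf v := by
      intro h
      have := (T.eq_endOf_iff (some ⟨⟨v, hv⟩, ⟨j.val - 1, by omega⟩⟩)).1 h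
      have hj' := j.2
      simp only [vert_some, pos_some] at this hj'
      omega
    have hj1 : j.val - 1 + 1 = j := by omega
    simp only [if_neg hj]
    by_cases hle : j.val + 1 ≤ T.time v
    · simp only [if_pos hle, vert_some, pos_some, hj1]
      rw [if_pos ⟨hne, hle⟩]
      rfl
    · simp only [if_neg hle, vert_some, pos_some, hj1]
      rw [if_pos ⟨hne, by omega⟩]
      rfl

/-- A slot with a nonzero amplitude is the slot of a vertex of the star. -/
theorem exists_of_slotAmplitude_ne_zero {p : ℕ} (hdepth : T.depth ≤ D)
    (hτ : T.maxTime ≤ τ) (h1 : 1 ≤ τ) (hΔ : T.maxDeg ≤ Δ) {x : T.Expanded} {c : Slot Δ}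
    (h : slotAmplitude Δ τ p desc hdepth x c ≠ 0) :
    ∃ z, (z = none → p = 0) ∧ T.owner p z = x ∧ T.slot Δ p z = c := by
  classical
  rw [slotAmplitude_eq p hdepth hτ h1] at h
  by_cases hx : T.parity x = p ∧ ¬ T.ExpMarked x
  swap
  · exact absurd (if_neg hx) h
  rw [if_pos hx] at h
  have hkey : ∀ z : T.Expanded, z ≠ none → T.expParent z = x → T.parity z ≠ p := by
    intro z hz hzx h'
    have h2 := T.parity_expParent hz
    have h3 := T.parity_lt x
    rw [hzx] at h2
    have := hx.1
    omega
  have hstep : x ≠ T.endOf (T.vert x) → ∃ z : T.Expanded, (z = none → p = 0) ∧ T.owner p z = x ∧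
      T.slot Δ p z = if T.pos x < T.time (T.vert x) then .next else .wait := by
    intro hend
    rcases x with _ | ⟨⟨v, hv⟩, j⟩
    · exact absurd T.endOf_root.symm hend
    have hj := T.pos_le_pathLen (some ⟨⟨v, hv⟩, j⟩)
    have hj' := mt (T.eq_endOf_iff (some ⟨⟨v, hv⟩, j⟩)).2 hend
    simp only [vert_some, pos_some] at hj hj'
    have hpar : T.expParent (some ⟨⟨v, hv⟩, ⟨j.val + 1, by dsimp only; omega⟩⟩) =
        some ⟨⟨v, hv⟩, j⟩ := rfl
    have hne := hkey _ (by simp) hpar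
    refine ⟨some ⟨⟨v, hv⟩, ⟨j.val + 1, by dsimp only; omega⟩⟩, by simp, ?_, ?_⟩
    · rw [owner, if_neg hne, hpar]
    · simp only [slot, if_neg hne]
      simp only [Nat.succ_ne_zero, if_false, vert_some, pos_some, Nat.succ_le_iff]
      rfl
  rcases c with _ | _ | _ | i
  · refine ⟨x, ?_, ?_, ?_⟩
    · rintro rfl
      exact hx.1.symm
    · rw [owner, if_pos hx.1]
    · rw [slot.eq_def, if_pos hx.1]
  · simp only at h
    split_ifs at h with h'
    · obtain ⟨z, hz⟩ := hstep h'.1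
      rw [if_pos h'.2] at hz
      exact ⟨z, hz⟩
    · exact absurd rfl h
  · simp only at h
    split_ifs at h with h'
    · obtain ⟨z, hz⟩ := hstep h'.1
      rw [if_neg (by omega)] at hz
      exact ⟨z, hz⟩
    · exact absurd rfl h
  · simp only at h
    split_ifs at h with h'
    · rw [val_flagDegree_endOf hΔ h'.1] at h'
      have hpar : T.expParent (some ⟨⟨T.child (T.vert x) ⟨i, h'.2⟩, T.child_ne_root _ _⟩,
          ⟨0, T.pathLen_pos _⟩⟩) = x := by
        simp only [expParent, if_true]
        rw [T.parent_eq ⟨_, rfl⟩, ← h'.1]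
      have hne := hkey _ (by simp) hpar
      refine ⟨some ⟨⟨T.child (T.vert x) ⟨i, h'.2⟩, T.child_ne_root _ _⟩,
        ⟨0, T.pathLen_pos _⟩⟩, by simp, by rw [owner, if_neg hne, hpar], ?_⟩
      simp only [slot, if_neg hne, if_true, index_child]
      congr 1
      exact Fin.ext (val_ofNat_of_le (by omega))
    · exact absurd rfl h

/-! ### The action of the circuits on the encoding states -/

variable [DecidableEq B] [DecidableEq V] [Fintype B] {b₀ : B} {O : Oracles B Δ τ}

theorem flagCircuit_place (hdepth : T.depth ≤ D) (hτ : T.maxTime ≤ τ) (h1 : 1 ≤ τ)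
    (hacc : O.Access b₀ T desc work) (x : T.Expanded) (c : Slot Δ) :
    Circuit.eval O.family flagCircuit *ᵥ
        (place desc work hdepth (T.vert x) (T.pos x) c 0 false false : WalkReg B Δ D τ → ℂ) =
      place desc work hdepth (T.vert x) (T.pos x) c (flagDegree Δ x) (flagMark x)
        (flagFinished x) := by
  classical
  simp only [flagCircuit, Circuit.eval, one_mul, ← Matrix.mulVec_mulVec]
  have hfin : (ctrlQuery .finished false finishedSplit (fun x => x.1.1 ≠ []) :
      Gate (OracleReg B Δ τ) (WalkReg B Δ D τ)).eval O.family *ᵥ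
        place desc work hdepth (T.vert x) (T.pos x) c 0 false false =
      place desc work hdepth (T.vert x) (T.pos x) c 0 false (flagFinished x) := by
    by_cases hx : T.vert x = T.root
    · have : flagFinished x = false := by simp [flagFinished, hx]
      rw [this]
      refine ctrlQuery_spread_of_not _ _ _ _ _ fun b => ?_
      simpa [finishedSplit] using (stackOf_eq_nil_iff hdepth desc _).2 hx
    · obtain ⟨u, i, hi⟩ := T.exists_isChild hx
      refine ctrlQuery_spread O.family .finished false finishedSplit _
        (fun b => (desc (T.parent (T.vert x)), Fin.ofNat _ (T.index (T.vert x)), b,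
          Fin.ofNat _ (min (T.pos x) (T.time (T.vert x))), false))
        (fun b => (desc (T.parent (T.vert x)), Fin.ofNat _ (T.index (T.vert x)), b,
          Fin.ofNat _ (min (T.pos x) (T.time (T.vert x))), flagFinished x))
        (stackOf Δ τ hdepth desc (T.vert x), Fin.ofNat _ (T.pos x), c, 0, false)
        (by simpa [stackOf_eq_nil_iff] using hx) (fun _ => rfl) (fun _ => rfl) ?_
      have h := hacc.finished_apply u i (min (T.pos x) (T.time (T.vert x)))
        (by rw [hi]; exact min_le_right _ _)
      have hflag : decide (T.time (T.vert x) ≤ min (T.pos x) (T.time (T.vert x))) =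
          flagFinished x := by
        simp [flagFinished, hx]
      rw [hi, hflag, finishedKet_eq_spread, finishedKet_eq_spread] at h
      rw [workState, if_neg hx, T.parent_eq ⟨i, hi⟩, ← hi, index_child, hi]
      exact h
  rw [hfin]
  have hend := isEnd_iff (Δ := Δ) (desc := desc) hdepth hτ h1 x
  by_cases hx : x = T.endOf (T.vert x)
  · -- At the end of a path, the work register holds the description of the vertex.
    have hle : T.time (T.vert x) ≤ T.pos x := by
      rw [(T.eq_endOf_iff x).1 hx]; exact T.time_le_pathLen _
    have hdeg : flagDegree Δ x = Fin.ofNat _ (T.deg (T.vert x)) := by rw [flagDegree, if_pos hx]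
    have hmark : flagMark x = T.marked (T.vert x) := by
      rw [flagMark, ← hx]; simp
    simp only [place, workState_of_le hacc hle]
    rw [ctrlQuery_spread O.family .degree false degreeSplit _
      (f' := fun b => (stackOf Δ τ hdepth desc (T.vert x), Fin.ofNat _ (T.pos x), c,
        flagDegree Δ x, false, flagFinished x, desc (T.parent (T.vert x)),
        Fin.ofNat _ (T.index (T.vert x)), b, Fin.ofNat _ (min (T.pos x) (T.time (T.vert x)))))
      (φ' := ket (desc (T.vert x)))
      (fun b => (b, 0)) (fun b => (b, flagDegree Δ x))
      (stackOf Δ τ hdepth desc (T.vert x), Fin.ofNat _ (T.pos x), c, false, flagFinished x,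
        desc (T.parent (T.vert x)), Fin.ofNat _ (T.index (T.vert x)),
        Fin.ofNat _ (min (T.pos x) (T.time (T.vert x))))
      (hend.2 hx) (fun _ => rfl) (fun _ => rfl)
      (by
        rw [spread_ket, spread_ket, hdeg]
        exact hacc.degree_apply (T.vert x))]
    refine ctrlQuery_spread O.family .mark false markSplit _
      (fun b => (b, false)) (fun b => (b, flagMark x))
      (stackOf Δ τ hdepth desc (T.vert x), Fin.ofNat _ (T.pos x), c, flagDegree Δ x,
        flagFinished x, desc (T.parent (T.vert x)), Fin.ofNat _ (T.index (T.vert x)),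
        Fin.ofNat _ (min (T.pos x) (T.time (T.vert x))))
      (hend.2 hx) (fun _ => rfl) (fun _ => rfl) ?_
    rw [spread_ket, spread_ket, hmark]
    exact hacc.mark_apply (T.vert x)
  · have hdeg : flagDegree Δ x = 0 := by rw [flagDegree, if_neg hx]
    have hmark : flagMark x = false := by simp [flagMark, hx]
    rw [hdeg, hmark, place, ctrlQuery_spread_of_not _ _ _ _ _ (fun b h => hx (hend.1 h)),
      ctrlQuery_spread_of_not _ _ _ _ _ (fun b h => hx (hend.1 h))]

theorem starGate_place (p : ℕ) (hdepth : T.depth ≤ D) (v : V) (k : ℕ) (c : Slot Δ)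
    (g : Fin (Δ + 1)) (m f : Bool) :
    (starGate p : Gate (OracleReg B Δ τ) (WalkReg B Δ D τ)).eval O.family *ᵥ
        place desc work hdepth v k c g m f =
      ∑ c', householder (amplitude p (stackOf Δ τ hdepth desc v) (Fin.ofNat _ k) g m f) c' c •
        place desc work hdepth v k c' g m f := by
  simp only [place, spread, Finset.smul_sum]
  rw [Finset.sum_comm, Matrix.mulVec_sum]
  refine Finset.sum_congr rfl fun b _ => ?_
  rw [Matrix.mulVec_smul, starGate, blockGate_ket, Finset.smul_sum]
  refine Finset.sum_congr rfl fun c' _ => ?_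
  rw [smul_comm]
  rfl

end ComputationTree

theorem householder_zero {C : Type} [Fintype C] [DecidableEq C] :
    householder (fun _ : C => 0) = 1 := by
  ext c d
  simp [householder]

theorem Oracles.Access.family_mem_unitary {B : Type} [Fintype B] [DecidableEq B] {Δ τ : ℕ}
    {O : Oracles B Δ τ} {b₀ : B} {V : Type} {T : ComputationTree V} {desc : V ↪ B}
    {work : V → ℕ → B → ℂ} (hacc : O.Access b₀ T desc work) (o : OracleName) :
    O.family o ∈ Matrix.unitaryGroup (OracleReg B Δ τ o) ℂ := by
  cases o
  · exact hacc.unitary_degree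
  · exact hacc.unitary_mark
  · exact hacc.unitary_step
  · exact hacc.unitary_finished

namespace ComputationTree

variable {V : Type} {T : ComputationTree V} {B : Type} {Δ D τ : ℕ} {desc : V ↪ B}
  {work : V → ℕ → B → ℂ} [Fintype V] [DecidableEq B] [DecidableEq V] [Fintype B] {b₀ : B}
  {O : Oracles B Δ τ}

/-! ### The walk circuit implements the walk -/

/-- A sum over the slots with nonzero amplitudes is a sum over the vertices of the star. -/
theorem sum_slot_eq [Nonempty B] {p : ℕ} (hdepth : T.depth ≤ D) (hτ : T.maxTime ≤ τ)
    (h1 : 1 ≤ τ) (hΔ : T.maxDeg ≤ Δ) (hacc : O.Access b₀ T desc work) {x : T.Expanded}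
    {M : Type} [AddCommMonoid M] (h : Slot Δ → M)
    (h0 : ∀ c, slotAmplitude Δ τ p desc hdepth x c = 0 → h c = 0) :
    open Classical in
    ∑ c, h c = ∑ z ∈ Finset.univ.filter fun z => (z = none → p = 0) ∧ T.owner p z = x,
      h (T.slot Δ p z) := by
  classical
  have hU : Circuit.eval O.family (gatherCircuit b₀ p : Circuit _ (WalkReg B Δ D τ)) ∈
      Matrix.unitaryGroup _ ℂ := Circuit.eval_mem_unitary _ hacc.family_mem_unitary _
  rw [← Finset.sum_image (g := fun z => T.slot Δ p z)]
  · symm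
    refine Finset.sum_subset (Finset.subset_univ _) fun c _ hc => h0 c ?_
    by_contra h'
    obtain ⟨z, hz⟩ := exists_of_slotAmplitude_ne_zero hdepth hτ h1 hΔ h'
    exact hc (Finset.mem_image.2 ⟨z, by simpa using ⟨hz.1, hz.2.1⟩, hz.2.2⟩)
  · -- Vertices of the star with the same slot are gathered to the same state.
    intro z hz z' hz' hslot
    simp only [Finset.coe_filter, Finset.mem_univ, true_and] at hz hz'
    by_contra hne
    have h2 := gatherCircuit_encState hdepth hτ h1 hacc p z
    have h3 := gatherCircuit_encState hdepth hτ h1 hacc p z'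
    simp only at hslot
    rw [hz.2, hslot] at h2
    rw [hz'.2, ← h2] at h3
    have h4 := mulVec_conjTranspose_of_unitary hU h3
    rw [mulVec_conjTranspose_of_unitary hU rfl] at h4
    have h5 := star_encState_dotProduct hdepth hτ h1 hΔ hacc z z'
    rw [h4, star_encState_dotProduct hdepth hτ h1 hΔ hacc, if_pos rfl, if_neg hne] at h5
    exact one_ne_zero h5

theorem diffusionCircuit_encState [Nonempty B] {p : ℕ} (hp : p < 2) (hdepth : T.depth ≤ D)
    (hτ : T.maxTime ≤ τ) (h1 : 1 ≤ τ) (hΔ : T.maxDeg ≤ Δ) (hacc : O.Access b₀ T desc work)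
    (y : T.Expanded) :
    Circuit.eval O.family (diffusionCircuit b₀ p) *ᵥ encState Δ τ desc work hdepth y =
      ∑ z, T.diffusion D τ p z y • encState Δ τ desc work hdepth z := by
  classical
  have hU : ∀ c : Circuit (OracleReg B Δ τ) (WalkReg B Δ D τ),
      Circuit.eval O.family c ∈ Matrix.unitaryGroup _ ℂ :=
    Circuit.eval_mem_unitary _ hacc.family_mem_unitary
  set x := T.owner p y with hx
  set a := slotAmplitude Δ τ p desc hdepth x with ha
  have hflag : ∀ c, (Circuit.eval O.family flagCircuit)ᴴ *ᵥ
      (place desc work hdepth (T.vert x) (T.pos x) c (flagDegree Δ x) (flagMark x)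
        (flagFinished x) : WalkReg B Δ D τ → ℂ) =
      place desc work hdepth (T.vert x) (T.pos x) c 0 false false := fun c =>
    mulVec_conjTranspose_of_unitary (hU _) (flagCircuit_place hdepth hτ h1 hacc x c)
  have hgather : ∀ z, T.owner p z = x → (Circuit.eval O.family (gatherCircuit b₀ p))ᴴ *ᵥ
      (place desc work hdepth (T.vert x) (T.pos x) (T.slot Δ p z) 0 false false :
        WalkReg B Δ D τ → ℂ) = encState Δ τ desc work hdepth z := fun z hz =>
    mulVec_conjTranspose_of_unitary (hU _)
      (by rw [gatherCircuit_encState hdepth hτ h1 hacc, hz])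
  have hmain : Circuit.eval O.family (diffusionCircuit b₀ p) *ᵥ encState Δ τ desc work hdepth y =
      (Circuit.eval O.family (gatherCircuit b₀ p))ᴴ *ᵥ
        ∑ c, householder a c (T.slot Δ p y) •
          (place desc work hdepth (T.vert x) (T.pos x) c 0 false false :
            WalkReg B Δ D τ → ℂ) := by
    rw [diffusionCircuit]
    simp only [Circuit.eval_append, Circuit.eval, Circuit.eval_inv, ← Matrix.mulVec_mulVec]
    rw [gatherCircuit_encState hdepth hτ h1 hacc, ← hx, flagCircuit_place hdepth hτ h1 hacc,
      starGate_place, Matrix.mulVec_sum]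
    simp only [Matrix.mulVec_smul, hflag]
    rfl
  rw [hmain]
  by_cases hy : (y = none → p = 0) ∧ ¬ T.ExpMarked x
  · have hstar : ∀ z, (z = none → p = 0) → T.owner p z = x →
        a (T.slot Δ p z) = T.starVec D τ x z := fun z hz hzx => by
      rw [ha, ← hzx]
      exact slotAmplitude_owner hp hdepth hτ h1 hΔ hz (by rw [hzx]; exact hy.2)
    have hpar : T.parity x = p := T.parity_owner hp hy.1
    have hzero : ∀ z, ¬ ((z = none → p = 0) ∧ T.owner p z = x) → T.starVec D τ x z = 0 :=
      fun z hz => T.starVec_eq_zero hp hpar fun h => hz ⟨h.1, h.2.symm⟩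
    have hnorm : ∑ c, a c ^ 2 = ∑ z, T.starVec D τ x z ^ 2 := by
      rw [sum_slot_eq hdepth hτ h1 hΔ hacc (x := x) (p := p) (fun c => a c ^ 2)
        (fun c hc => by simp only [← ha] at hc; simp [hc]), Finset.sum_filter]
      refine Finset.sum_congr rfl fun z _ => ?_
      split_ifs with hz
      · rw [hstar z hz.1 hz.2]
      · rw [hzero z hz]; simp
    have hsum : (Circuit.eval O.family (gatherCircuit b₀ p))ᴴ *ᵥ
        ∑ c, (a c : ℂ) • (place desc work hdepth (T.vert x) (T.pos x) c 0 false false :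
          WalkReg B Δ D τ → ℂ) =
        ∑ z, (T.starVec D τ x z : ℂ) • encState Δ τ desc work hdepth z := by
      rw [sum_slot_eq hdepth hτ h1 hΔ hacc (x := x) (p := p) _
        (fun c hc => by simp only [← ha] at hc; simp [hc]), Finset.sum_filter, Matrix.mulVec_sum]
      refine Finset.sum_congr rfl fun z _ => ?_
      split_ifs with hz
      · rw [Matrix.mulVec_smul, hgather z hz.2, hstar z hz.1 hz.2]
      · rw [hzero z hz]; simp
    set n := ∑ z, T.starVec D τ x z ^ 2 with hn
    have hH : ∑ c, householder a c (T.slot Δ p y) •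
        (place desc work hdepth (T.vert x) (T.pos x) c 0 false false : WalkReg B Δ D τ → ℂ) =
        place desc work hdepth (T.vert x) (T.pos x) (T.slot Δ p y) 0 false false -
        ((2 * T.starVec D τ x y / n : ℝ) : ℂ) • ∑ c, (a c : ℂ) •
          (place desc work hdepth (T.vert x) (T.pos x) c 0 false false :
            WalkReg B Δ D τ → ℂ) := by
      simp only [householder, hnorm, Matrix.sub_apply, Matrix.smul_apply, Matrix.of_apply,
        Matrix.one_apply, sub_smul, Finset.sum_sub_distrib, ite_smul, one_smul, zero_smul,
        Finset.sum_ite_eq', Finset.mem_univ, if_true, Finset.smul_sum, smul_smul]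
      congr 1
      refine Finset.sum_congr rfl fun c _ => ?_
      congr 1
      rw [hstar y hy.1 rfl, smul_eq_mul]
      push_cast
      ring
    rw [hH, Matrix.mulVec_sub, Matrix.mulVec_smul, hsum, hgather y rfl]
    simp only [T.diffusion_apply D τ hp, ← hx, if_pos hy, sub_smul, Finset.sum_sub_distrib,
      ite_smul, one_smul, zero_smul, Finset.sum_ite_eq', Finset.mem_univ, if_true,
      Finset.smul_sum, smul_smul]
    congr 1
    refine Finset.sum_congr rfl fun z _ => ?_
    congr 1
    rw [← hn]
    push_cast
    ring
  · have ha0 : a = fun _ => 0 := by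
      ext c
      rw [ha, slotAmplitude_eq p hdepth hτ h1, if_neg]
      rintro ⟨hpar, hm⟩
      refine hy ⟨?_, hm⟩
      intro hyn
      rw [← hpar, hx, hyn, owner_root]
      rfl
    rw [ha0, householder_zero]
    simp only [Matrix.one_apply, ite_smul, one_smul, zero_smul, Finset.sum_ite_eq',
      Finset.mem_univ, if_true]
    rw [hgather y rfl]
    simp only [T.diffusion_apply D τ hp, ← hx, if_neg hy, sub_zero, ite_smul, one_smul,
      zero_smul, Finset.sum_ite_eq', Finset.mem_univ, if_true]

/-- The encoding of the expanded tree as an isometry. -/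
def encMatrix (Δ τ : ℕ) (desc : V ↪ B) (work : V → ℕ → B → ℂ) (hdepth : T.depth ≤ D) :
    Matrix (WalkReg B Δ D τ) T.Expanded ℂ :=
  Matrix.of fun s x => encState Δ τ desc work hdepth x s

theorem encMatrix_isometry (hdepth : T.depth ≤ D) (hτ : T.maxTime ≤ τ) (h1 : 1 ≤ τ)
    (hΔ : T.maxDeg ≤ Δ) (hacc : O.Access b₀ T desc work) :
    (encMatrix Δ τ desc work hdepth)ᴴ * encMatrix Δ τ desc work hdepth = 1 := by
  ext x y
  rw [Matrix.one_apply, ← star_encState_dotProduct hdepth hτ h1 hΔ hacc x y]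
  rfl

theorem encMatrix_root (hdepth : T.depth ≤ D) :
    encMatrix Δ τ desc work hdepth *ᵥ ket none =
      ket (⟨[], Nat.zero_le _⟩, Fin.ofNat _ 1, .self, 0, false, false, desc T.root,
        Fin.ofNat _ 0, desc T.root, Fin.ofNat _ 0) := by
  rw [mulVec_ket]
  change encState Δ τ desc work hdepth none = _
  have hstack : stackOf Δ τ hdepth desc T.root = ⟨[], Nat.zero_le _⟩ :=
    Subtype.ext ((stackOf_eq_nil_iff hdepth desc _).2 rfl)
  rw [encState, place]
  simp only [vert, pos, workState, if_true, hstack, parent_root, index_root, T.time_root,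
    Nat.min_zero]
  rw [spread_ket]

theorem diffusionCircuit_mul_encMatrix [Nonempty B] {p : ℕ} (hp : p < 2) (hdepth : T.depth ≤ D)
    (hτ : T.maxTime ≤ τ) (h1 : 1 ≤ τ) (hΔ : T.maxDeg ≤ Δ) (hacc : O.Access b₀ T desc work) :
    (Circuit.eval O.family (diffusionCircuit b₀ p) :
        Matrix (WalkReg B Δ D τ) (WalkReg B Δ D τ) ℂ) * encMatrix Δ τ desc work hdepth =
      encMatrix Δ τ desc work hdepth * (T.diffusion D τ p : Matrix T.Expanded T.Expanded ℂ) := by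
  ext s y
  have h := congrFun (diffusionCircuit_encState hp hdepth hτ h1 hΔ hacc y) s
  rw [Finset.sum_apply] at h
  refine h.trans ?_
  rw [Matrix.mul_apply]
  refine Finset.sum_congr rfl fun z _ => ?_
  rw [Pi.smul_apply, smul_eq_mul, mul_comm]
  rfl

theorem walkCircuit_mul_encMatrix [Nonempty B] (hdepth : T.depth ≤ D) (hτ : T.maxTime ≤ τ)
    (h1 : 1 ≤ τ) (hΔ : T.maxDeg ≤ Δ) (hacc : O.Access b₀ T desc work) :
    (Circuit.eval O.family (walkCircuit b₀) :
        Matrix (WalkReg B Δ D τ) (WalkReg B Δ D τ) ℂ) * encMatrix Δ τ desc work hdepth =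
      encMatrix Δ τ desc work hdepth * (T.walkStep D τ : Matrix T.Expanded T.Expanded ℂ) := by
  rw [walkCircuit, Circuit.eval_append, Matrix.mul_assoc,
    diffusionCircuit_mul_encMatrix two_pos hdepth hτ h1 hΔ hacc, ← Matrix.mul_assoc,
    diffusionCircuit_mul_encMatrix one_lt_two hdepth hτ h1 hΔ hacc, Matrix.mul_assoc, walkStep]

end ComputationTree

/-! ### Detection -/

section Detection

variable {S : Type} [Fintype S] [DecidableEq S]

/-- The squared norm of the average of the first `n + 1` powers of `W` at `|s⟩`. -/
def averageNormSq (W : Matrix S S ℂ) (n : ℕ) (s : S) : ℝ :=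
  ∑ x, ‖(((n + 1 : ℝ)⁻¹ : ℝ) • ∑ k ∈ Finset.range (n + 1), W ^ k *ᵥ ket s) x‖ ^ 2

theorem averageNormSq_nonneg (W : Matrix S S ℂ) (n : ℕ) (s : S) : 0 ≤ averageNormSq W n s :=
  Finset.sum_nonneg fun _ _ => by positivity

theorem sum_norm_sq_averageCircuit {W : Matrix S S ℂ} (hW : W ∈ Matrix.unitaryGroup S ℂ)
    (n : ℕ) (s : S) :
    ∑ x, ‖(Circuit.eval (fun _ : Unit => W) (averageCircuit S n) *ᵥ ket (s, 0)) x‖ ^ 2 = 1 := by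
  have : Nonempty S := ⟨s⟩
  rw [sum_norm_sq_mulVec_of_unitary, sum_norm_sq_ket]
  exact Circuit.eval_mem_unitary _ (fun _ => hW) _

theorem sum_accept_averageCircuit (W : Matrix S S ℂ) (n : ℕ) (s : S) :
    ∑ x ∈ Finset.univ.filter (fun a : S × Fin (n + 1) => a.2 = 0),
      ‖(Circuit.eval (fun _ : Unit => W) (averageCircuit S n) *ᵥ ket (s, 0)) x‖ ^ 2 =
      averageNormSq W n s := by
  rw [averageNormSq, Finset.sum_filter, Fintype.sum_prod_type]
  refine Finset.sum_congr rfl fun x _ => ?_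
  rw [← averageCircuit_apply]
  simp

theorem averageNormSq_le_one {W : Matrix S S ℂ} (hW : W ∈ Matrix.unitaryGroup S ℂ) (n : ℕ)
    (s : S) : averageNormSq W n s ≤ 1 := by
  rw [← sum_accept_averageCircuit, ← sum_norm_sq_averageCircuit hW n s]
  exact Finset.sum_le_sum_of_subset_of_nonneg (Finset.subset_univ _) fun _ _ _ => by positivity

/-- Two runs of `averageCircuit`, one of which measures the exponent register in its initial
state. -/
theorem acceptance_twice {W : Matrix S S ℂ} (hW : W ∈ Matrix.unitaryGroup S ℂ)
    (n : ℕ) (s : S) :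
    ∑ p ∈ (Finset.univ : Finset ((S × Fin (n + 1)) × (S × Fin (n + 1)))).filter
        (fun p => p.1 ∈ Finset.univ.filter (fun a : S × Fin (n + 1) => a.2 = 0) ∨
          p.2 ∈ Finset.univ.filter fun a : S × Fin (n + 1) => a.2 = 0),
      ‖(Circuit.eval (fun _ : Unit => W) (averageCircuit S n).twice *ᵥ
        ket ((s, 0), (s, 0))) p‖ ^ 2 =
      1 - (1 - averageNormSq W n s) ^ 2 := by
  rw [Circuit.eval_twice, sum_accept_twice _ (sum_norm_sq_averageCircuit hW n s),
    sum_accept_averageCircuit]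

variable {E : Type} [Fintype E] [DecidableEq E]

/-- If `U` has an invariant vector with at least half of its squared norm at `r`, then at least half
of the squared norm at the encoding of `r` survives the averaging. -/
theorem averageNormSq_ge {W : Matrix S S ℂ} (hW : W ∈ Matrix.unitaryGroup S ℂ) (n : ℕ) (s : S)
    {enc : Matrix S E ℂ} (h1 : encᴴ * enc = 1) {r : E} (hr : enc *ᵥ ket r = ket s)
    {U : Matrix E E ℂ} (hU : W * enc = enc * U) {φ : E → ℝ}
    (hφ : U *ᵥ (fun y => (φ y : ℂ)) = fun y => (φ y : ℂ)) (hpos : 0 < φ r)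
    (hnorm : ∑ y, φ y ^ 2 ≤ 2 * φ r ^ 2) : 1 / 2 ≤ averageNormSq W n s := by
  set ψ := enc *ᵥ fun y => (φ y : ℂ) with hψ
  have hinv : W *ᵥ ψ = ψ := by
    rw [hψ, Matrix.mulVec_mulVec, hU, ← Matrix.mulVec_mulVec, hφ]
  have hleft : star ψ ᵥ* W = star ψ := by
    rw [← star_star W, Matrix.star_eq_conjTranspose, Matrix.star_eq_conjTranspose,
      ← Matrix.star_mulVec, mulVec_conjTranspose_of_unitary hW hinv]
  have hs : ψ s = φ r := by
    have : ψ s = star (ket s) ⬝ᵥ ψ := by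
      rw [dotProduct, Finset.sum_eq_single s] <;> simp +contextual [ket_apply]
    rw [this, ← hr, hψ, Matrix.star_mulVec, Matrix.dotProduct_mulVec, Matrix.vecMul_vecMul, h1,
      Matrix.vecMul_one, dotProduct, Finset.sum_eq_single r] <;> simp +contextual [ket_apply]
  have hψn : ∑ x, ‖ψ x‖ ^ 2 = ∑ y, φ y ^ 2 := by
    rw [hψ, sum_norm_sq_mulVec_of_isometry enc h1]
    simp
  have h := le_average_pow n s (star ψ) hleft
  simp only [Pi.star_apply, norm_star] at h
  rw [hψn, hs, Complex.norm_real, Real.norm_eq_abs, sq_abs] at h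
  change φ r ^ 2 ≤ (∑ y, φ y ^ 2) * averageNormSq W n s at h
  have h0 := averageNormSq_nonneg W n s
  have h2 : (∑ y, φ y ^ 2) * averageNormSq W n s ≤ 2 * φ r ^ 2 * averageNormSq W n s :=
    mul_le_mul_of_nonneg_right hnorm h0
  have h3 : 0 < φ r ^ 2 := by positivity
  by_contra hlt
  rw [not_le] at hlt
  nlinarith

theorem averageNormSq_le {W : Matrix S S ℂ} (hW : W ∈ Matrix.unitaryGroup S ℂ) (n : ℕ) (s : S)
    {enc : Matrix S E ℂ} (h1 : encᴴ * enc = 1) {r : E} (hr : enc *ᵥ ket r = ket s)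
    {U : Matrix E E ℂ} (hU : W * enc = enc * U) {w : E → ℝ} (hw : ∀ y, 0 < w y)
    (h : (fun y => ((√(w y) : ℝ) : ℂ)) - U *ᵥ (fun y => ((√(w y) : ℝ) : ℂ)) =
      ((2 * √(w r) : ℝ) : ℂ) • ket r) :
    w r * averageNormSq W n s ≤ (∑ y, w y) / (n + 1) ^ 2 := by
  have h2 : (enc *ᵥ fun y => ((√(w y) : ℝ) : ℂ)) - W *ᵥ (enc *ᵥ fun y => ((√(w y) : ℝ) : ℂ)) =
      ((2 * √(w r) : ℝ) : ℂ) • ket s := by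
    rw [Matrix.mulVec_mulVec, hU, ← Matrix.mulVec_mulVec, ← Matrix.mulVec_sub, h,
      Matrix.mulVec_smul, hr]
  have h3 := average_pow_le hW n s _ _ h2
  rw [sum_norm_sq_mulVec_of_isometry enc h1] at h3
  change _ * averageNormSq W n s ≤ _ at h3
  have h4 : ∑ y, ‖((√(w y) : ℝ) : ℂ)‖ ^ 2 = ∑ y, w y := Finset.sum_congr rfl fun y _ => by
    rw [Complex.norm_real, Real.norm_eq_abs, sq_abs, Real.sq_sqrt (hw y).le]
  rw [h4, mul_pow, Real.sq_sqrt (hw r).le, mul_div_assoc] at h3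
  linarith

end Detection

theorem log_two_add_one_le {τ : ℕ} (h : 1 ≤ τ) :
    (Nat.log 2 τ : ℝ) + 1 ≤ 2 * (1 + Real.log τ) := by
  have h1 : (2 : ℝ) ^ Nat.log 2 τ ≤ τ := by
    exact_mod_cast Nat.pow_log_le_self 2 (by omega : τ ≠ 0)
  have h2 := Real.log_le_log (by positivity) h1
  rw [Real.log_pow] at h2
  have h3 := Real.log_two_gt_d9
  have h4 : (0 : ℝ) ≤ Nat.log 2 τ := Nat.cast_nonneg _
  nlinarith

/-- The algorithm: `walkCircuit` as the walk step, and two runs of `averageCircuit` with exponents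
up to `n` as the main circuit. -/
def detection {B : Type} [Fintype B] [DecidableEq B] (b₀ bᵣ : B) (Δ D τ n : ℕ) :
    DetectionAlgorithm B Δ τ where
  S := WalkReg B Δ D τ
  walk := walkCircuit b₀
  rootState := (⟨[], Nat.zero_le _⟩, Fin.ofNat _ 1, .self, 0, false, false, bᵣ, Fin.ofNat _ 0, bᵣ,
    Fin.ofNat _ 0)
  X := (WalkReg B Δ D τ × Fin (n + 1)) × (WalkReg B Δ D τ × Fin (n + 1))
  main := (averageCircuit (WalkReg B Δ D τ) n).twice
  start := (((⟨[], Nat.zero_le _⟩, Fin.ofNat _ 1, .self, 0, false, false, bᵣ, Fin.ofNat _ 0, bᵣ,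
    Fin.ofNat _ 0), 0), ((⟨[], Nat.zero_le _⟩, Fin.ofNat _ 1, .self, 0, false, false, bᵣ,
    Fin.ofNat _ 0, bᵣ, Fin.ofNat _ 0), 0))
  accept := Finset.univ.filter fun p =>
    p.1 ∈ Finset.univ.filter (fun a : WalkReg B Δ D τ × Fin (n + 1) => a.2 = 0) ∨
      p.2 ∈ Finset.univ.filter fun a : WalkReg B Δ D τ × Fin (n + 1) => a.2 = 0

theorem mainTheorem2 :
    ∃ (c : ℝ) (q : ℕ), ∀ (B : Type) [Fintype B] [DecidableEq B] (b₀ bᵣ : B) (Δ D τ N : ℕ),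
      1 ≤ D → 1 ≤ τ → 1 ≤ N →
      ∃ alg : DetectionAlgorithm B Δ τ,
        (alg.main.queryCount : ℝ) ≤ c * √((N : ℝ) * D * (1 + Real.log τ)) ∧
        alg.walk.queryCount ≤ q ∧
        ∀ (V : Type) [Fintype V] [DecidableEq V] (T : ComputationTree V) (desc : V ↪ B)
          (work : V → ℕ → B → ℂ) (O : Oracles B Δ τ),
          T.maxDeg ≤ Δ → T.depth ≤ D → T.maxTime ≤ τ → T.sqTime ≤ N →
          desc T.root = bᵣ → O.Access b₀ T desc work →
          alg.ImplementsWalk O (T.walkStep D τ) none ∧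
          ((∃ v, T.marked v = true) → 2 / 3 ≤ alg.acceptProb O) ∧
          ((∀ v, T.marked v = false) → alg.acceptProb O ≤ 1 / 3) := by
  refine ⟨14, 16, ?_⟩
  intro B _ _ b₀ bᵣ Δ D τ N hD hτ1 hN
  have hD' : (1 : ℝ) ≤ D := by exact_mod_cast hD
  have hN' : (1 : ℝ) ≤ N := by exact_mod_cast hN
  have hlog : 0 ≤ Real.log τ := Real.log_natCast_nonneg τ
  set L : ℝ := (Nat.log 2 τ : ℝ) + 1 with hL
  have hL0 : 0 < L := by positivity
  -- With this number of powers, the average has squared norm at most `1 / 6` in the absence of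
  -- marked vertices.
  set n : ℕ := ⌊√(14 * N * D * L)⌋₊ with hn
  have hn1 : 14 * N * D * L ≤ ((n : ℝ) + 1) ^ 2 := by
    have h := (Nat.lt_floor_add_one (√(14 * N * D * L))).le
    calc 14 * N * D * L = √(14 * N * D * L) ^ 2 := (Real.sq_sqrt (by positivity)).symm
      _ ≤ ((n : ℝ) + 1) ^ 2 := by gcongr
  refine ⟨detection b₀ bᵣ Δ D τ n, ?_, (walkCircuit_queryCount b₀).le, ?_⟩
  · have hq : (detection b₀ bᵣ Δ D τ n).main.queryCount = 2 * n := by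
      exact (Circuit.queryCount_twice _).trans (congrArg (2 * ·) (averageCircuit_queryCount n))
    rw [hq]
    push_cast
    have h1 : (n : ℝ) ≤ √(14 * N * D * L) := Nat.floor_le (Real.sqrt_nonneg _)
    have h2 : √(14 * N * D * L) ≤ √(7 ^ 2 * (N * D * (1 + Real.log τ))) := by
      refine Real.sqrt_le_sqrt ?_
      have h3 : (0 : ℝ) < N * D := by positivity
      have h4 := mul_le_mul_of_nonneg_left (log_two_add_one_le hτ1) h3.le
      have h5 : 0 ≤ (N : ℝ) * D * (1 + Real.log τ) := by positivity
      rw [hL]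
      nlinarith
    rw [Real.sqrt_mul (by positivity : (0 : ℝ) ≤ 7 ^ 2), Real.sqrt_sq (by positivity)] at h2
    linarith
  intro V _ _ T desc work O hΔ hdepth hτ hsq hroot hacc
  have : Nonempty B := ⟨b₀⟩
  subst hroot
  set s : WalkReg B Δ D τ := (⟨[], Nat.zero_le _⟩, Fin.ofNat _ 1, .self, 0, false, false,
    desc T.root, Fin.ofNat _ 0, desc T.root, Fin.ofNat _ 0) with hs
  set W : Matrix (WalkReg B Δ D τ) (WalkReg B Δ D τ) ℂ :=
    Circuit.eval O.family (walkCircuit b₀) with hWdef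
  have : Nonempty (WalkReg B Δ D τ) := ⟨s⟩
  have hW : W ∈ Matrix.unitaryGroup _ ℂ :=
    Circuit.eval_mem_unitary _ hacc.family_mem_unitary _
  have hiso := ComputationTree.encMatrix_isometry hdepth hτ hτ1 hΔ hacc
  have hr : ComputationTree.encMatrix Δ τ desc work hdepth *ᵥ ket none = ket s :=
    ComputationTree.encMatrix_root hdepth
  have hU := ComputationTree.walkCircuit_mul_encMatrix hdepth hτ hτ1 hΔ hacc
  have hacceptProb : (detection b₀ (desc T.root) Δ D τ n).acceptProb O =
      1 - (1 - averageNormSq W n s) ^ 2 := acceptance_twice hW n s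
  refine ⟨⟨_, hiso, hr, hU⟩, ?_, ?_⟩
  · rintro ⟨v, hv⟩
    obtain ⟨φ, hφ, hpos, hnorm⟩ := T.exists_invariant hD hτ hdepth hv
    have h := averageNormSq_ge hW n s hiso hr hU hφ hpos hnorm
    have h' := averageNormSq_le_one hW n s
    rw [hacceptProb]
    nlinarith
  · intro hm
    have hm' : ∀ x, ¬ T.ExpMarked x := fun x h => by
      have := ((T.expMarked_iff x).1 h).2
      rw [hm] at this
      exact Bool.false_ne_true this
    have h := averageNormSq_le hW n s hiso hr hU (T.weight_pos hD τ)
      (T.sub_walkStep_mulVec_sqrt_weight hD hm')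
    have hsum := T.sum_weight_le (τ := τ) hD
    have hsq' : (T.sqTime : ℝ) ≤ N := by exact_mod_cast hsq
    have h6 : averageNormSq W n s ≤ 1 / 6 := by
      have hw : T.weight D τ none = 1 / (D * L) := rfl
      have hDL : (0 : ℝ) < D * L := by positivity
      rw [hw, div_mul_eq_mul_div, one_mul, div_le_div_iff₀ hDL (by positivity)] at h
      have h7 : (∑ y, T.weight D τ y) * (D * L) ≤ 7 / 3 * N * (D * L) := by
        gcongr
        linarith
      have h8 : averageNormSq W n s * (14 * N * D * L) ≤
          averageNormSq W n s * ((n : ℝ) + 1) ^ 2 :=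
        mul_le_mul_of_nonneg_left hn1 (averageNormSq_nonneg W n s)
      have h9 : 0 < (N : ℝ) * (D * L) := by positivity
      by_contra hlt
      rw [not_le] at hlt
      nlinarith
    rw [hacceptProb]
    nlinarith [sq_nonneg (averageNormSq W n s)]
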